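/- Let $(M,g)$ be a space-time, i.e. a smooth manifold of dimension $n\ge 3$ with a smooth nondegenerate metric $g$ of arbitrary signature $(p,q)$. Let $\nabla$ be its Levi-Civita connection, $P=\frac1{n-2}\bigl(\mathrm{Ric}-\frac{\mathrm{Sc}}{2(n-1)}g\bigr)$ its Schouten tensor and $J=\mathrm{tr}_gP$. *Tractors.* In the scale $\tau_g$ of $g$, the tractor space at $x\in M$ is $\mathcal T_x=\mathbb R X\oplus T_xM\oplus\mathbb R Y$, with elements $\sigma X+\mu\cdot Z+\rho Y$. The tractor metric $k$ is given by $k(X,X)=k(Y,Y)=0$, $k(X,Y)=1$, $k|_{T_xM}=g_x$ and $T_xM\perp X,Y$. The tractor connection is $\nabla X=Z$, $\nabla Z=-PX-gY$, $\nabla Y=g^{-1}(Z)\cdot P$. For a section $V$ of weight $w$ of a tractor bundle, the tractor $D$-operator is $$DV=(n+2w-2)\,w\,Y\otimes V+(n+2w-2)\,g^{-1}(Z,\nabla V)-X\otimes(\Delta V+wJV),$$ which lowers the weight by one. Densities are trivialized by $\tau_g$, so that the weight two density $\tau_g^2$ is the constant function $1$. *Quadric cosmologies.* Let $\mathbb K\subset\mathbb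 P(\mathcal T_x)$ be the projective null cone of $k$, with marked point $[X]$. A quadric cosmology on $\mathcal T_x$ is a metric on the part of $\mathbb K$ where $q\neq0$ of the form $$g_q=\frac{k(dv,dv)}{q(v,v)},$$ where $q$ is a symmetric bilinear form on $\mathcal T_x$, linearly independent of $k$. Its scale $\tau_q$ is given by $\tau_q^2=q(v,v)$, a density of weight two on $\mathbb K$, i.e. a function homogeneous of degree two on the null cone. The tractor bundle of $\mathbb K$ is trivial with fibre $\mathcal T_x$, and its $D$-operator on functions $f$ homogeneous of degree $w$, extended off the null cone, is $Df=(n+2w-2)\,df-k(v,\cdot)\otimes\Delta_kf$ at $v$, with $\Delta_k$ the Laplacian of the flat metric $k$ on $\mathcal T_x$. *Osculation.* The quadric cosmology $g_q$ osculates with $g$ at $x$ if the weight two densities $\tau_g^2$ at $x$ and $\tau_q^2$ at the marked point $X$ have equal values and equal first and second tractor $D$-derivatives: $$\tau_g^2(x)=\tau_q^2(X),\qquad D\tau_g^2(x)=D\tau_q^2(X),\qquad D^2\tau_g^2(x)=D^2\tau_q^2(X).$$ **Theorem.** At each point $x$ of $M$ there is a unique quadric cosmology on $\mathcal T_x$ that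 osculates with $g$ at $x$. -/

import Mathlib

open scoped Manifold ContDiff Topology LinearAlgebra.Projectivization

set_option maxSynthPendingDepth 3

noncomputable section

/-! ## Pseudo-Riemannian metrics and their expressions in charts -/

/-- A smooth pseudo-Riemannian metric, of arbitrary signature, on a manifold modelled on `E`. -/
structure SpaceTimeMetric (E : Type*) [NormedAddCommGroup E] [NormedSpace ℝ E]
    (M : Type*) [TopologicalSpace M] [ChartedSpace E M] [IsManifold 𝓘(ℝ, E) ∞ M] where
  val : ∀ x : M, TangentSpace 𝓘(ℝ, E) x →L[ℝ] TangentSpace 𝓘(ℝ, E) x →L[ℝ] ℝ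
  symm : ∀ (x : M) (u v : TangentSpace 𝓘(ℝ, E) x), val x u v = val x v u
  nondegenerate : ∀ (x : M) (u : TangentSpace 𝓘(ℝ, E) x), (∀ v, val x u v = 0) → u = 0
  contMDiff : ContMDiff 𝓘(ℝ, E) (𝓘(ℝ, E).prod 𝓘(ℝ, E →L[ℝ] E →L[ℝ] ℝ)) ∞
    (fun x ↦ Bundle.TotalSpace.mk' (E →L[ℝ] E →L[ℝ] ℝ) x (val x))

section Chart

variable {E : Type*} [NormedAddCommGroup E] [NormedSpace ℝ E]
  {M : Type*} [TopologicalSpace M] [ChartedSpace E M] [IsManifold 𝓘(ℝ, E) ∞ M]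

/-- The expression of the metric in the preferred chart at `x`, that is, its pull-back under the
inverse of the chart. It is meaningful at the points of the target of the chart. -/
def SpaceTimeMetric.inChart (g : SpaceTimeMetric E M) (x : M) (y : E) : E →L[ℝ] E →L[ℝ] ℝ :=
  ContinuousLinearMap.bilinearComp (E := E) (F := E) (E' := E) (F' := E)
    (g.val ((extChartAt 𝓘(ℝ, E) x).symm y))
    (mfderiv 𝓘(ℝ, E) 𝓘(ℝ, E) (extChartAt 𝓘(ℝ, E) x).symm y)
    (mfderiv 𝓘(ℝ, E) 𝓘(ℝ, E) (extChartAt 𝓘(ℝ, E) x).symm y)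

theorem SpaceTimeMetric.inChart_apply (g : SpaceTimeMetric E M) (x : M) (y u v : E) :
    g.inChart x y u v = g.val ((extChartAt 𝓘(ℝ, E) x).symm y)
      (mfderiv 𝓘(ℝ, E) 𝓘(ℝ, E) (extChartAt 𝓘(ℝ, E) x).symm y u)
      (mfderiv 𝓘(ℝ, E) 𝓘(ℝ, E) (extChartAt 𝓘(ℝ, E) x).symm y v) := rfl

/-- At `x` itself the chart identifies the tangent space with `E`, by definition of the latter. -/
theorem SpaceTimeMetric.inChart_self (g : SpaceTimeMetric E M) (x : M) :
    g.inChart x (extChartAt 𝓘(ℝ, E) x x) = (g.val x : E →L[ℝ] E →L[ℝ] ℝ) := by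
  have h : mfderiv 𝓘(ℝ, E) 𝓘(ℝ, E) (extChartAt 𝓘(ℝ, E) x).symm (extChartAt 𝓘(ℝ, E) x x) =
      ContinuousLinearMap.id ℝ E := by
    have : IsManifold 𝓘(ℝ, E) 1 M := IsManifold.of_le (n := ∞) (by simp)
    have h1 := mfderivWithin_range_extChartAt_symm (I := 𝓘(ℝ, E)) (x := x)
    rw [show Set.range (𝓘(ℝ, E)) = Set.univ by simp, mfderivWithin_univ] at h1
    exact h1
  have h2 : ∀ z : M, z = x → ∀ u v : E, g.val z u v = g.val x u v := by
    rintro z rfl u v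
    rfl
  ext u v
  rw [SpaceTimeMetric.inChart_apply]
  have hu : ∀ u : E, mfderiv 𝓘(ℝ, E) 𝓘(ℝ, E) (extChartAt 𝓘(ℝ, E) x).symm
      (extChartAt 𝓘(ℝ, E) x x) u = u := fun u ↦ congrArg (fun L : E →L[ℝ] E ↦ L u) h
  have h3 := h2 _ (extChartAt_to_inv (I := 𝓘(ℝ, E)) x) u v
  exact (congrArg₂ (fun a b : E ↦
    g.val ((extChartAt 𝓘(ℝ, E) x).symm (extChartAt 𝓘(ℝ, E) x x)) a b) (hu u) (hu v)).trans h3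

/-- The expression of the metric in a chart is smooth. -/
theorem SpaceTimeMetric.contDiffOn_inChart [FiniteDimensional ℝ E] (g : SpaceTimeMetric E M)
    (x : M) : ContDiffOn ℝ ∞ (g.inChart x) (extChartAt 𝓘(ℝ, E) x).target := by
  rw [contDiffOn_clm_apply]
  intro u
  rw [contDiffOn_clm_apply]
  intro v
  rw [← contMDiffOn_iff_contDiffOn]
  have hopen : IsOpen (extChartAt 𝓘(ℝ, E) x).target := isOpen_extChartAt_target x
  have hsymm : ContMDiffOn 𝓘(ℝ, E) 𝓘(ℝ, E) ∞ (extChartAt 𝓘(ℝ, E) x).symm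
      (extChartAt 𝓘(ℝ, E) x).target := contMDiffOn_extChartAt_symm x
  have hvec : ∀ u : E, ContMDiffOn 𝓘(ℝ, E) (𝓘(ℝ, E).prod 𝓘(ℝ, E)) ∞
      (fun y : E ↦ Bundle.TotalSpace.mk' E (E := (TangentSpace 𝓘(ℝ, E) : M → Type _))
        ((extChartAt 𝓘(ℝ, E) x).symm y)
        (mfderiv 𝓘(ℝ, E) 𝓘(ℝ, E) (extChartAt 𝓘(ℝ, E) x).symm y u))
      (extChartAt 𝓘(ℝ, E) x).target := by
    intro u
    have h1 := hsymm.contMDiffOn_tangentMapWithin (m := ∞) (by simp) hopen.uniqueMDiffOn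
    have h2 : ContMDiff 𝓘(ℝ, E) (𝓘(ℝ, E).prod 𝓘(ℝ, E)) ∞
        (fun y : E ↦ Bundle.TotalSpace.mk' E (E := (TangentSpace 𝓘(ℝ, E) : E → Type _)) y u) := by
      exact contMDiff_vectorSpace_iff_contDiff.2 contDiff_const
    have h3 := h1.comp h2.contMDiffOn (s := (extChartAt 𝓘(ℝ, E) x).target) (fun y hy ↦ hy)
    refine h3.congr ?_
    intro y hy
    simp only [Function.comp, tangentMapWithin]
    rw [mfderivWithin_of_isOpen hopen hy]
  intro y hy
  have := ((g.contMDiff.contMDiffAt.comp_contMDiffWithinAt y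
    (hsymm y hy))).clm_bundle_apply₂ (F₁ := E) (F₂ := E) (F₃ := ℝ)
      (E₃ := fun _ : M ↦ ℝ) (hvec u y hy) (hvec v y hy)
  rw [Bundle.contMDiffWithinAt_totalSpace] at this
  exact this.2

end Chart

/-! ## Local pseudo-Riemannian geometry in an open piece of a vector space -/

section Local

variable {E : Type*} [NormedAddCommGroup E] [NormedSpace ℝ E] [FiniteDimensional ℝ E]
  {F : Type*} [NormedAddCommGroup F] [NormedSpace ℝ F]

/-- The elements of the dual basis of a fixed basis of `E`. -/
def coordForm (E : Type*) [NormedAddCommGroup E] [NormedSpace ℝ E] [FiniteDimensional ℝ E]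
    (i : Fin (Module.finrank ℝ E)) : E →L[ℝ] ℝ :=
  LinearMap.toContinuousLinearMap ((Module.finBasis ℝ E).coord i)

/-- The contraction `k^{ij} B_{ij}` of a bilinear map `B` with the inverse of a nondegenerate
bilinear form `k`. Here `k.inverse : E* → E` inverts `k : E → E*`. -/
def metricTrace (k : E →L[ℝ] E →L[ℝ] ℝ) (B : E → E → F) : F :=
  ∑ i, B (Module.finBasis ℝ E i) (k.inverse (coordForm E i))

/-- The Levi-Civita connection with all indices down:
`(u, v, w) ↦ (∂_u g(v, w) + ∂_v g(u, w) - ∂_w g(u, v)) / 2`. -/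
def christoffelLower (g : E → E →L[ℝ] E →L[ℝ] ℝ) (y : E) : E →L[ℝ] E →L[ℝ] E →L[ℝ] ℝ :=
  (1 / 2 : ℝ) • (fderiv ℝ g y + (fderiv ℝ g y).flip -
    ContinuousLinearMap.comp
      (ContinuousLinearMap.flipₗᵢ ℝ E E ℝ).toContinuousLinearEquiv.toContinuousLinearMap
      (fderiv ℝ g y).flip)

theorem christoffelLower_apply (g : E → E →L[ℝ] E →L[ℝ] ℝ) (y u v w : E) :
    christoffelLower g y u v w =
      1 / 2 * (fderiv ℝ g y u v w + fderiv ℝ g y v u w - fderiv ℝ g y w u v) := by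
  simp [christoffelLower]

/-- The Christoffel symbol: `∇_u v = ∂_u v + Γ(u, v)`. -/
def christoffel (g : E → E →L[ℝ] E →L[ℝ] ℝ) (y : E) : E →L[ℝ] E →L[ℝ] E :=
  (ContinuousLinearMap.compL ℝ E (E →L[ℝ] ℝ) E (g y).inverse) ∘L christoffelLower g y

/-- The Riemann curvature `R(u, v) w = (∂_u Γ)(v, w) - (∂_v Γ)(u, w) + Γ(u, Γ(v, w)) -
Γ(v, Γ(u, w))`, as a bilinear map of `v` and `w`. -/
def riemann (g : E → E →L[ℝ] E →L[ℝ] ℝ) (y u : E) : E →L[ℝ] E →L[ℝ] E :=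
  fderiv ℝ (christoffel g) y u - (fderiv ℝ (christoffel g) y).flip u
    + (ContinuousLinearMap.compL ℝ E E E (christoffel g y u)) ∘L christoffel g y
    - ((ContinuousLinearMap.compL ℝ E E E).flip (christoffel g y u)) ∘L christoffel g y

theorem riemann_apply (g : E → E →L[ℝ] E →L[ℝ] ℝ) (y u v w : E) :
    riemann g y u v w = fderiv ℝ (christoffel g) y u v w - fderiv ℝ (christoffel g) y v u w
      + christoffel g y u (christoffel g y v w) - christoffel g y v (christoffel g y u w) := by
  simp [riemann]

/-- The Ricci curvature: `Ric(v, w)` is the trace of `u ↦ R(u, v) w`. -/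
def ricci (g : E → E →L[ℝ] E →L[ℝ] ℝ) (y : E) : E →L[ℝ] E →L[ℝ] ℝ :=
  ∑ i, (ContinuousLinearMap.compL ℝ E E ℝ (coordForm E i)) ∘L riemann g y (Module.finBasis ℝ E i)

/-- The scalar curvature. -/
def scalarCurvature (g : E → E →L[ℝ] E →L[ℝ] ℝ) (y : E) : ℝ :=
  metricTrace (g y) fun u v ↦ ricci g y u v

/-- The Schouten tensor `P = (Ric - Sc g / (2 (n - 1))) / (n - 2)`. -/
def schouten (g : E → E →L[ℝ] E →L[ℝ] ℝ) (y : E) : E →L[ℝ] E →L[ℝ] ℝ :=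
  ((Module.finrank ℝ E : ℝ) - 2)⁻¹ •
    (ricci g y - (scalarCurvature g y / (2 * ((Module.finrank ℝ E : ℝ) - 1))) • g y)

/-- The metric trace of the Schouten tensor. -/
def schoutenTrace (g : E → E →L[ℝ] E →L[ℝ] ℝ) (y : E) : ℝ :=
  metricTrace (g y) fun u v ↦ schouten g y u v

/-! ## Tractors -/

/-- The fibre of the tractor bundle in the splitting given by a metric of the conformal class:
`(σ, μ, ρ)` stands for `σ X + μ · Z + ρ Y`. -/
abbrev Tractor (E : Type*) : Type _ := ℝ × E × ℝ

/-- The coefficient of `X`. -/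
def Tractor.coeffX (E : Type*) [NormedAddCommGroup E] [NormedSpace ℝ E] : Tractor E →L[ℝ] ℝ :=
  ContinuousLinearMap.fst ℝ ℝ (E × ℝ)

/-- The coefficient of `Z`. -/
def Tractor.coeffZ (E : Type*) [NormedAddCommGroup E] [NormedSpace ℝ E] : Tractor E →L[ℝ] E :=
  ContinuousLinearMap.fst ℝ E ℝ ∘L ContinuousLinearMap.snd ℝ ℝ (E × ℝ)

/-- The coefficient of `Y`. -/
def Tractor.coeffY (E : Type*) [NormedAddCommGroup E] [NormedSpace ℝ E] : Tractor E →L[ℝ] ℝ :=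
  ContinuousLinearMap.snd ℝ E ℝ ∘L ContinuousLinearMap.snd ℝ ℝ (E × ℝ)

/-- The canonical null tractor `X`, which spans the marked point. -/
def Tractor.X (E : Type*) [NormedAddCommGroup E] [NormedSpace ℝ E] : Tractor E := (1, 0, 0)

/-- The tractor metric: `X` and `Y` are null, `k(X, Y) = 1`, and `k(Z, Z)` is the metric. -/
def tractorMetric {E : Type*} [NormedAddCommGroup E] [NormedSpace ℝ E]
    (b : E →L[ℝ] E →L[ℝ] ℝ) : Tractor E →L[ℝ] Tractor E →L[ℝ] ℝ :=
  (ContinuousLinearMap.mul ℝ ℝ).bilinearComp (Tractor.coeffX E) (Tractor.coeffY E)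
    + (ContinuousLinearMap.mul ℝ ℝ).bilinearComp (Tractor.coeffY E) (Tractor.coeffX E)
    + b.bilinearComp (Tractor.coeffZ E) (Tractor.coeffZ E)

theorem tractorMetric_apply {E : Type*} [NormedAddCommGroup E] [NormedSpace ℝ E]
    (b : E →L[ℝ] E →L[ℝ] ℝ) (s t : Tractor E) :
    tractorMetric b s t = s.1 * t.2.2 + s.2.2 * t.1 + b s.2.1 t.2.1 := by
  simp [tractorMetric, Tractor.coeffX, Tractor.coeffY, Tractor.coeffZ]

/-- The connection form of the tractor connection, coupled to the Levi-Civita connection: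
`∇X = Z`, `∇Z = -P X - g Y`, `∇Y = P^♯ Z`. -/
def tractorConnection (g : E → E →L[ℝ] E →L[ℝ] ℝ) (y : E) :
    E →L[ℝ] Tractor E →L[ℝ] Tractor E :=
  LinearMap.toContinuousBilinearMap <| LinearMap.mk₂ ℝ
    (fun (v : E) (s : Tractor E) ↦
      ((-schouten g y v s.2.1,
        s.1 • v + christoffel g y v s.2.1 + s.2.2 • (g y).inverse (schouten g y v),
        -g y v s.2.1) : Tractor E))
    (by intro v v' s; ext <;> simp <;> module)
    (by intro c v s; ext <;> simp <;> module)
    (by intro v s s'; ext <;> simp <;> module)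
    (by intro c v s; ext <;> simp <;> module)

/-- The connection form of the dual connection on cotractors. -/
def cotractorConnection (g : E → E →L[ℝ] E →L[ℝ] ℝ) (y : E) :
    E →L[ℝ] (Tractor E →L[ℝ] ℝ) →L[ℝ] (Tractor E →L[ℝ] ℝ) :=
  -((ContinuousLinearMap.compL ℝ (Tractor E) (Tractor E) ℝ).flip ∘L tractorConnection g y)

/-- The covariant derivative `∇_v V = ∂_v V + A(v) V` of a section `V` of a bundle with
connection form `A`. Densities are trivialized by the scale of the metric, which is parallel. -/
def covDeriv (A : E → E →L[ℝ] F →L[ℝ] F) (V : E → F) (y : E) : E →L[ℝ] F :=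
  fderiv ℝ V y + (A y).flip (V y)

/-- The Laplacian `g^{ij} ∇_i ∇_j V`, the outer derivative being coupled to the Levi-Civita
connection. -/
def coupledLaplacian (g : E → E →L[ℝ] E →L[ℝ] ℝ) (A : E → E →L[ℝ] F →L[ℝ] F) (V : E → F)
    (y : E) : F :=
  metricTrace (g y) fun u v ↦
    fderiv ℝ (covDeriv A V) y u v + A y u (covDeriv A V y v) - covDeriv A V y (christoffel g y u v)

/-- The tractor `D`-operator on sections of weight `w` of a bundle with connection form `A`, in
the scale of the metric `g`:
`D V = (n + 2w - 2) w Y ⊗ V + (n + 2w - 2) g⁻¹(Z, ∇V) - X ⊗ (ΔV + w (tr P) V)`.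
Its values are cotractors with values in the bundle, that is, linear maps of the tractor
`s = (σ, μ, ρ)`, and `k(Y, s) = σ`, `k(X, s) = ρ`, and `g⁻¹(Z, ∇V)` contracted with `s` is
`∇_μ V`. -/
def tractorD (g : E → E →L[ℝ] E →L[ℝ] ℝ) (A : E → E →L[ℝ] F →L[ℝ] F) (w : ℝ) (V : E → F)
    (y : E) : Tractor E →L[ℝ] F :=
  (((Module.finrank ℝ E : ℝ) + 2 * w - 2) * w) • (Tractor.coeffX E).smulRight (V y)
    + ((Module.finrank ℝ E : ℝ) + 2 * w - 2) • (covDeriv A V y ∘L Tractor.coeffZ E)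
    - (Tractor.coeffY E).smulRight (coupledLaplacian g A V y + (w * schoutenTrace g y) • V y)

/-- The tractor `D`-operator on densities of weight `w`, trivialized by the scale of `g`. -/
def densityD (g : E → E →L[ℝ] E →L[ℝ] ℝ) (w : ℝ) (f : E → ℝ) : E → Tractor E →L[ℝ] ℝ :=
  tractorD g (fun _ ↦ 0) w f

/-- The iterated operator `D² = D ⊗ D` on densities of weight `w`; the inner `D` takes values in
cotractors of weight `w - 1`. -/
def densityD2 (g : E → E →L[ℝ] E →L[ℝ] ℝ) (w : ℝ) (f : E → ℝ) :
    E → Tractor E →L[ℝ] Tractor E →L[ℝ] ℝ :=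
  tractorD g (cotractorConnection g) (w - 1) (densityD g w f)

/-- The weight two density `τ²` given by the scale `τ` of the metric `g`, trivialized by `τ`. -/
def scaleSq (_g : E → E →L[ℝ] E →L[ℝ] ℝ) : E → ℝ := fun _ ↦ 1

end Local

/-! ## The flat model: the projective null cone of a quadratic vector space -/

section Model

variable {V : Type*} [NormedAddCommGroup V] [NormedSpace ℝ V]

/-- The projective null cone of `k`. -/
def NullQuadric (k : V →L[ℝ] V →L[ℝ] ℝ) : Type _ :=
  {p : ℙ ℝ V // ∀ v ∈ p.submodule, k v v = 0}

/-- The orthogonal complement of the line `p` (all forms of interest are symmetric). -/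
def NullQuadric.perp {k : V →L[ℝ] V →L[ℝ] ℝ} (p : NullQuadric k) : Submodule ℝ V where
  carrier := {a | ∀ v ∈ p.1.submodule, k v a = 0 ∧ k a v = 0}
  add_mem' := by
    intro a b ha hb v hv
    simp [ha v hv, hb v hv]
  zero_mem' := by
    intro v _
    simp
  smul_mem' := by
    intro c a ha v hv
    simp [ha v hv]

/-- The quotient `p^⊥ / p`. -/
abbrev NullQuadric.PerpMod {k : V →L[ℝ] V →L[ℝ] ℝ} (p : NullQuadric k) : Type _ :=
  p.perp ⧸ (p.1.submodule.comap p.perp.subtype)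

/-- The tangent space `Hom(p, p^⊥ / p)` of the projective null cone at the point `p`: the velocity
of a curve `[x(t)]` sends `x(0)` to the class of `x'(0)`. -/
abbrev NullQuadric.Tangent {k : V →L[ℝ] V →L[ℝ] ℝ} (p : NullQuadric k) : Type _ :=
  p.1.submodule →ₗ[ℝ] p.PerpMod

/-- The bilinear form induced by `k` on `p^⊥ / p`. -/
def NullQuadric.perpForm {k : V →L[ℝ] V →L[ℝ] ℝ} (p : NullQuadric k) :
    p.PerpMod →ₗ[ℝ] p.PerpMod →ₗ[ℝ] ℝ :=
  Submodule.liftQ _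
    { toFun := fun a ↦ Submodule.liftQ _ ((k (a : V)).toLinearMap ∘ₗ p.perp.subtype) (by
        intro v hv
        simpa using (a.2 v hv).2)
      map_add' := by
        intro a b
        apply LinearMap.ext
        intro c
        obtain ⟨c, rfl⟩ := Submodule.Quotient.mk_surjective _ c
        simp
      map_smul' := by
        intro r a
        apply LinearMap.ext
        intro c
        obtain ⟨c, rfl⟩ := Submodule.Quotient.mk_surjective _ c
        simp }
    (by
      intro v hv
      apply LinearMap.ext
      intro c
      obtain ⟨c, rfl⟩ := Submodule.Quotient.mk_surjective _ c
      simpa using (c.2 v hv).1)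

theorem NullQuadric.perpForm_mk {k : V →L[ℝ] V →L[ℝ] ℝ} (p : NullQuadric k) (a b : p.perp) :
    p.perpForm (Submodule.Quotient.mk a) (Submodule.Quotient.mk b) = k a b := rfl

/-- A tensor field of type `(0, 2)` on a subset of the projective null cone. -/
abbrev PartialMetric (k : V →L[ℝ] V →L[ℝ] ℝ) : Type _ :=
  (p : NullQuadric k) → Option (p.Tangent →ₗ[ℝ] p.Tangent →ₗ[ℝ] ℝ)

theorem NullQuadric.rep_mem {k : V →L[ℝ] V →L[ℝ] ℝ} (p : NullQuadric k) :
    p.1.rep ∈ p.1.submodule := by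
  rw [Projectivization.submodule_eq]
  exact Submodule.mem_span_singleton_self _

open Classical in
/-- The metric `g_q = k(dx, dx) / q(x, x)` on the part of the projective null cone of `k` where
`q` does not vanish. -/
def quadricCosmology (k q : V →L[ℝ] V →L[ℝ] ℝ) : PartialMetric k := fun p ↦
  if q p.1.rep p.1.rep = 0 then none
  else some ((q p.1.rep p.1.rep)⁻¹ •
    p.perpForm.compl₁₂ (LinearMap.applyₗ (⟨p.1.rep, p.rep_mem⟩ : p.1.submodule))
      (LinearMap.applyₗ (⟨p.1.rep, p.rep_mem⟩ : p.1.submodule)))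

variable [FiniteDimensional ℝ V] {F : Type*} [NormedAddCommGroup F] [NormedSpace ℝ F]

/-- The Laplacian of the flat metric `k`. -/
def flatLaplacian (k : V →L[ℝ] V →L[ℝ] ℝ) (f : V → F) (v : V) : F :=
  metricTrace k fun a b ↦ fderiv ℝ (fderiv ℝ f) v a b

/-- The tractor `D`-operator of the projective null cone of `k`, of dimension `n = dim V - 2`.
The tractor bundle of the null cone is trivial with fibre `V`, a section of weight `w` of a tensor
power of it is a function on the null cone that is homogeneous of degree `w`, and, for any smooth
homogeneous extension of the function to a neighbourhood of the null cone,
`D f = (n + 2w - 2) df - k(v, ·) ⊗ Δf` at `v`. -/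
def modelD (k : V →L[ℝ] V →L[ℝ] ℝ) (w : ℝ) (f : V → F) (v : V) : V →L[ℝ] F :=
  (((Module.finrank ℝ V : ℝ) - 2) + 2 * w - 2) • fderiv ℝ f v
    - (k v).smulRight (flatLaplacian k f v)

/-- The iterated operator `D²` on densities of weight `w` on the projective null cone. -/
def modelD2 (k : V →L[ℝ] V →L[ℝ] ℝ) (w : ℝ) (f : V → ℝ) : V → V →L[ℝ] V →L[ℝ] ℝ :=
  modelD k (w - 1) (modelD k w f)

/-- The weight two density `τ_q²` on the projective null cone given by the scale of `g_q`. -/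
def quadricScaleSq (q : V →L[ℝ] V →L[ℝ] ℝ) : V → ℝ := fun v ↦ q v v

end Model

/-! ## Osculation -/

section Osculation

variable {E : Type*} [NormedAddCommGroup E] [NormedSpace ℝ E] [FiniteDimensional ℝ E]
  {M : Type*} [TopologicalSpace M] [ChartedSpace E M] [IsManifold 𝓘(ℝ, E) ∞ M]

/-- The tractor metric on the tractor space `ℝ X ⊕ T_x M ⊕ ℝ Y` at `x`. -/
def SpaceTimeMetric.tractorForm (g : SpaceTimeMetric E M) (x : M) :
    Tractor E →L[ℝ] Tractor E →L[ℝ] ℝ :=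
  tractorMetric (E := E) (g.val x)

/-- The densities `f` on the space-time (in the chart at `x`, trivialized by the scale of `g`) and
`h` on the projective null cone in the tractor space at `x`, both of weight `w`, osculate at `x`
and the marked point `[X]`: their values, first, and second tractor `D`-derivatives agree. -/
def SpaceTimeMetric.DensitiesOsculate (g : SpaceTimeMetric E M) (x : M) (w : ℝ)
    (f : E → ℝ) (h : Tractor E → ℝ) : Prop :=
  f (extChartAt 𝓘(ℝ, E) x x) = h (Tractor.X E) ∧
  densityD (g.inChart x) w f (extChartAt 𝓘(ℝ, E) x x)
    = modelD (g.tractorForm x) w h (Tractor.X E) ∧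
  densityD2 (g.inChart x) w f (extChartAt 𝓘(ℝ, E) x x)
    = modelD2 (g.tractorForm x) w h (Tractor.X E)

/-- The metric `G` on a part of the projective null cone in the tractor space at `x` is a quadric
cosmology `k(dx, dx) / q(x, x)` that osculates with `g` at `x`. -/
def SpaceTimeMetric.IsOsculatingQuadricCosmology (g : SpaceTimeMetric E M) (x : M)
    (G : PartialMetric (g.tractorForm x)) : Prop :=
  ∃ q : Tractor E →L[ℝ] Tractor E →L[ℝ] ℝ,
    (∀ s t, q s t = q t s) ∧
    LinearIndependent ℝ ![g.tractorForm x, q] ∧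
    G = quadricCosmology (g.tractorForm x) q ∧
    g.DensitiesOsculate x 2 (scaleSq (g.inChart x)) (quadricScaleSq q)

end Osculation

end

/-! On the flat model everything is linear algebra. The density `q(v,v)` is quadratic in `v`, so its
first tractor `D`-derivative is linear in `v` and its second is a constant form. With `n + 2` the
dimension of the tractor space, that form is `2n(n+2)` times the trace-free part of `q`
(`modelD2_quadricScaleSq`). Hence the second-derivative condition alone fixes `q` modulo `k`, and
`g_q` depends on `q` only modulo `k` because `k` vanishes on the cone (`quadricCosmology_congr`).
This is uniqueness.

For existence, `q` has to be `S / (2n(n+2))` with `S = D²τ_g²`, which requires `S` to be symmetric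
and trace free. In its own scale `τ_g²` is constant, so `Dτ_g² = 2(n+2) Y - 2J X`
(`densityD_scaleSq`), and differentiating again gives the entries of `S`
(`IsLocalMetric.exists_densityD2_apply`). Symmetry of its `Z`–`X` entries is the identity `div P =
dJ` (`IsLocalMetric.divergence_schouten`), a form of the twice contracted second Bianchi identity;
symmetry of the `Z`–`Z` block also uses that `Ric` is symmetric. The trace vanishes by cancellation
of the `J` terms (`IsLocalMetric.metricTrace_densityD2`).

The two lower-order conditions then come for free: contracting `S` with the marked point `X` gives
`n Dτ_g²`, and contracting twice gives `2n(n+2)`. -/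

/-! ### Contractions with a nondegenerate bilinear form -/

section Trace

variable {E : Type*} [NormedAddCommGroup E] [NormedSpace ℝ E] [FiniteDimensional ℝ E]
  {F : Type*} [NormedAddCommGroup F] [NormedSpace ℝ F]

theorem coordForm_apply (i : Fin (Module.finrank ℝ E)) (v : E) :
    coordForm E i v = (Module.finBasis ℝ E).repr v i := rfl

theorem sum_coordForm_smul (v : E) : ∑ i, coordForm E i v • Module.finBasis ℝ E i = v :=
  (Module.finBasis ℝ E).sum_repr v

theorem sum_smul_coordForm (φ : E →L[ℝ] ℝ) :
    ∑ i, φ (Module.finBasis ℝ E i) • coordForm E i = φ := by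
  ext v
  conv_rhs => rw [← sum_coordForm_smul v]
  simp [mul_comm]

theorem sum_coordForm_apply (T : E →ₗ[ℝ] E) :
    ∑ i, coordForm E i (T (Module.finBasis ℝ E i)) = LinearMap.trace ℝ E T := by
  rw [LinearMap.trace_eq_matrix_trace ℝ (Module.finBasis ℝ E), Matrix.trace]
  simp [LinearMap.toMatrix_apply, coordForm_apply]

theorem sum_coordForm_comp_comm (S T : E →L[ℝ] E) :
    ∑ i, coordForm E i (S (T (Module.finBasis ℝ E i))) =
      ∑ i, coordForm E i (T (S (Module.finBasis ℝ E i))) := by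
  have h := LinearMap.trace_mul_comm ℝ (S : E →ₗ[ℝ] E) (T : E →ₗ[ℝ] E)
  rw [← sum_coordForm_apply, ← sum_coordForm_apply] at h
  exact h

/-- Transposition of an endomorphism inside a contraction. -/
theorem sum_transpose (B : E →L[ℝ] (E →L[ℝ] ℝ) →L[ℝ] F) (T : E →L[ℝ] E) :
    ∑ i, B (Module.finBasis ℝ E i) (coordForm E i ∘L T) =
      ∑ i, B (T (Module.finBasis ℝ E i)) (coordForm E i) := by
  have h1 : ∀ i, coordForm E i ∘L T =
      ∑ j, coordForm E i (T (Module.finBasis ℝ E j)) • coordForm E j :=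
    fun i ↦ (sum_smul_coordForm (coordForm E i ∘L T)).symm
  have h2 : ∀ j, B (T (Module.finBasis ℝ E j)) (coordForm E j) =
      ∑ i, coordForm E i (T (Module.finBasis ℝ E j)) •
        B (Module.finBasis ℝ E i) (coordForm E j) := by
    intro j
    conv_lhs => rw [← sum_coordForm_smul (T (Module.finBasis ℝ E j))]
    simp
  simp_rw [h1, h2, map_sum, map_smul]
  exact Finset.sum_comm

/-- Nondegeneracy is injectivity of `E → E*`, and the two spaces have equal finite dimension. -/
theorem isInvertible_of_nondegenerate (b : E →L[ℝ] E →L[ℝ] ℝ)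
    (h : ∀ u, (∀ v, b u v = 0) → u = 0) : b.IsInvertible := by
  have hinj : Function.Injective b := by
    rw [injective_iff_map_eq_zero]
    intro u hu
    exact h u fun v ↦ by simp [hu]
  have hdim : Module.finrank ℝ E = Module.finrank ℝ (E →L[ℝ] ℝ) := by
    rw [← LinearEquiv.finrank_eq (LinearMap.toContinuousLinearMap (𝕜 := ℝ) (E := E) (F' := ℝ))]
    exact (Subspace.dual_finrank_eq (K := ℝ) (V := E)).symm
  refine ⟨(LinearEquiv.ofInjectiveOfFinrankEq (b : E →ₗ[ℝ] (E →L[ℝ] ℝ)) hinj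
    hdim).toContinuousLinearEquiv, ?_⟩
  ext u v
  rfl

variable {b : E →L[ℝ] E →L[ℝ] ℝ}

theorem apply_inverse_coordForm (hb : b.IsInvertible) (i : Fin (Module.finrank ℝ E)) (v : E) :
    b (b.inverse (coordForm E i)) v = coordForm E i v := by
  rw [hb.self_apply_inverse]

theorem sum_smul_inverse_coordForm (b : E →L[ℝ] E →L[ℝ] ℝ) (φ : E →L[ℝ] ℝ) :
    ∑ i, φ (Module.finBasis ℝ E i) • b.inverse (coordForm E i) = b.inverse φ := by
  conv_rhs => rw [← sum_smul_coordForm φ]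
  simp

theorem metricTrace_comm (hb : b.IsInvertible) (hs : ∀ u v, b u v = b v u)
    (B : E →L[ℝ] E →L[ℝ] F) :
    metricTrace b (fun u v ↦ B u v) = metricTrace b (fun u v ↦ B v u) := by
  have h1 : ∀ j, b.inverse (coordForm E j) =
      ∑ i, coordForm E i (b.inverse (coordForm E j)) • Module.finBasis ℝ E i :=
    fun j ↦ (sum_coordForm_smul _).symm
  -- The inverse matrix is symmetric: both sides are `b` evaluated on the two raised coordinate
  -- forms.
  have h2 : ∀ i j, coordForm E i (b.inverse (coordForm E j)) =
      coordForm E j (b.inverse (coordForm E i)) := by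
    intro i j
    rw [← apply_inverse_coordForm hb i, ← apply_inverse_coordForm hb j, hs]
  unfold metricTrace
  calc _ = ∑ i, ∑ j, coordForm E j (b.inverse (coordForm E i)) •
        B (Module.finBasis ℝ E i) (Module.finBasis ℝ E j) := by
        refine Finset.sum_congr rfl fun i _ ↦ ?_
        conv_lhs => rw [h1 i]
        simp
    _ = ∑ i, ∑ j, coordForm E j (b.inverse (coordForm E i)) •
        B (Module.finBasis ℝ E j) (Module.finBasis ℝ E i) := by
        rw [Finset.sum_comm]
        simp_rw [h2]
    _ = _ := by
        refine Finset.sum_congr rfl fun i _ ↦ ?_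
        conv_rhs => rw [h1 i]
        simp

theorem metricTrace_self (hb : b.IsInvertible) (hs : ∀ u v, b u v = b v u) :
    metricTrace b (fun u v ↦ b u v) = Module.finrank ℝ E := by
  rw [metricTrace_comm hb hs]
  simp [metricTrace, apply_inverse_coordForm hb, coordForm_apply]

/-- Expressing the contraction as the trace of an endomorphism frees it from the chosen basis; on
the tractor space this permits a basis adapted to the splitting. -/
theorem metricTrace_eq_trace (hb : b.IsInvertible) (hs : ∀ u v, b u v = b v u)
    (B : E →L[ℝ] E →L[ℝ] ℝ) :
    metricTrace b (fun u v ↦ B u v) =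
      LinearMap.trace ℝ E ((b.inverse ∘L B : E →L[ℝ] E) : E →ₗ[ℝ] E) := by
  rw [← sum_coordForm_apply]
  refine Finset.sum_congr rfl fun i _ ↦ ?_
  rw [← apply_inverse_coordForm hb i, hs]
  simp [hb.self_apply_inverse]

end Trace

/-! ### Levi-Civita connection, curvature and Bianchi identities on an open set -/

section LocalMetric

variable {E : Type*} [NormedAddCommGroup E] [NormedSpace ℝ E]
  {F : Type*} [NormedAddCommGroup F] [NormedSpace ℝ F]

/-- A smooth pseudo-Riemannian metric on an open subset of a vector space. -/
structure IsLocalMetric (g : E → E →L[ℝ] E →L[ℝ] ℝ) (U : Set E) : Prop where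
  isOpen : IsOpen U
  contDiffOn : ContDiffOn ℝ ∞ g U
  symm : ∀ y ∈ U, ∀ u v, g y u v = g y v u
  isInvertible : ∀ y ∈ U, (g y).IsInvertible

theorem fderiv_apply_apply {B : E → E →L[ℝ] E →L[ℝ] F} {a c : E → E} {y : E}
    (hB : DifferentiableAt ℝ B y) (ha : DifferentiableAt ℝ a y) (hc : DifferentiableAt ℝ c y)
    (e : E) :
    fderiv ℝ (fun z ↦ B z (a z) (c z)) y e =
      fderiv ℝ B y e (a y) (c y) + B y (fderiv ℝ a y e) (c y) + B y (a y) (fderiv ℝ c y e) := by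
  have h := (hB.hasFDerivAt.clm_apply ha.hasFDerivAt).clm_apply hc.hasFDerivAt
  rw [h.fderiv]
  simp
  abel

theorem fderiv_apply_apply_const {G H : Type*} [NormedAddCommGroup G] [NormedSpace ℝ G]
    [NormedAddCommGroup H] [NormedSpace ℝ H] {B : E → G →L[ℝ] H →L[ℝ] F} {y : E}
    (hB : DifferentiableAt ℝ B y) (e : E) (u : G) (v : H) :
    fderiv ℝ (fun z ↦ B z u v) y e = fderiv ℝ B y e u v := by
  have h := (hB.hasFDerivAt.clm_apply (hasFDerivAt_const u y)).clm_apply (hasFDerivAt_const v y)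
  rw [h.fderiv]
  simp

theorem fderiv_fderiv_comm {f : E → F} {y : E} (hf : ContDiffAt ℝ ∞ f y) (u v : E) :
    fderiv ℝ (fderiv ℝ f) y u v = fderiv ℝ (fderiv ℝ f) y v u :=
  (hf.isSymmSndFDerivAt (by simpa using WithTop.coe_le_coe.2 (le_top : (2 : ℕ∞) ≤ ⊤))).eq u v

theorem ContDiffOn.differentiableAt_of_isOpen {f : E → F} {U : Set E} {y : E}
    (hf : ContDiffOn ℝ ∞ f U) (hU : IsOpen U) (hy : y ∈ U) : DifferentiableAt ℝ f y :=
  (hf.contDiffAt (hU.mem_nhds hy)).differentiableAt (by simp)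

theorem ContDiffOn.fderiv_infty {f : E → F} {U : Set E} (hf : ContDiffOn ℝ ∞ f U)
    (hU : IsOpen U) : ContDiffOn ℝ ∞ (fderiv ℝ f) U :=
  hf.fderiv_of_isOpen hU (by simp)

/-- Tensor identities are available only on `U`; openness is what allows them to be differentiated.
-/
theorem fderiv_congr_on {f h : E → F} {U : Set E} {y : E} (hU : IsOpen U) (hy : y ∈ U)
    (hfh : ∀ z ∈ U, f z = h z) : fderiv ℝ f y = fderiv ℝ h y :=
  Filter.EventuallyEq.fderiv_eq (Filter.eventually_of_mem (hU.mem_nhds hy) hfh)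

namespace IsLocalMetric

variable [FiniteDimensional ℝ E]
variable {g : E → E →L[ℝ] E →L[ℝ] ℝ} {U : Set E} {y : E}

theorem contDiffOn_inverse (hg : IsLocalMetric g U) :
    ContDiffOn ℝ ∞ (fun y ↦ (g y).inverse) U := fun y hy ↦
  ((hg.isInvertible y hy).contDiffAt_map_inverse.comp_contDiffWithinAt y (hg.contDiffOn y hy))

theorem contDiffOn_christoffelLower (hg : IsLocalMetric g U) :
    ContDiffOn ℝ ∞ (christoffelLower g) U := by
  have h := hg.contDiffOn.fderiv_infty hg.isOpen
  simp_rw [contDiffOn_clm_apply, christoffelLower_apply]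
  intro u v w
  have hc : ∀ a b c : E, ContDiffOn ℝ ∞ (fun y ↦ fderiv ℝ g y a b c) U := fun a b c ↦
    ((h.clm_apply contDiffOn_const).clm_apply contDiffOn_const).clm_apply contDiffOn_const
  exact contDiffOn_const.mul (((hc _ _ _).add (hc _ _ _)).sub (hc _ _ _))

theorem christoffel_apply (g : E → E →L[ℝ] E →L[ℝ] ℝ) (y u v : E) :
    christoffel g y u v = (g y).inverse (christoffelLower g y u v) := rfl

theorem contDiffOn_christoffel (hg : IsLocalMetric g U) :
    ContDiffOn ℝ ∞ (christoffel g) U := by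
  simp_rw [contDiffOn_clm_apply, christoffel_apply]
  intro u v
  exact hg.contDiffOn_inverse.clm_apply
    ((hg.contDiffOn_christoffelLower.clm_apply contDiffOn_const).clm_apply contDiffOn_const)

theorem contDiffOn_riemann (hg : IsLocalMetric g U) (u : E) :
    ContDiffOn ℝ ∞ (fun y ↦ riemann g y u) U := by
  have h0 := hg.contDiffOn_christoffel
  have h := h0.fderiv_infty hg.isOpen
  simp_rw [contDiffOn_clm_apply, riemann_apply]
  intro v w
  have hc : ∀ a b c : E, ContDiffOn ℝ ∞ (fun y ↦ fderiv ℝ (christoffel g) y a b c) U :=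
    fun a b c ↦
    ((h.clm_apply contDiffOn_const).clm_apply contDiffOn_const).clm_apply contDiffOn_const
  have hd : ∀ (a : E) (b : E → E), ContDiffOn ℝ ∞ b U →
      ContDiffOn ℝ ∞ (fun y ↦ christoffel g y a (b y)) U :=
    fun a b hb ↦ (h0.clm_apply contDiffOn_const).clm_apply hb
  exact (((hc _ _ _).sub (hc _ _ _)).add (hd _ _ (hd _ _ contDiffOn_const))).sub
    (hd _ _ (hd _ _ contDiffOn_const))

theorem ricci_apply (g : E → E →L[ℝ] E →L[ℝ] ℝ) (y v w : E) :
    ricci g y v w = ∑ i, coordForm E i (riemann g y (Module.finBasis ℝ E i) v w) := by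
  simp [ricci]

theorem contDiffOn_ricci (hg : IsLocalMetric g U) : ContDiffOn ℝ ∞ (ricci g) U := by
  simp_rw [contDiffOn_clm_apply, ricci_apply]
  intro v w
  exact ContDiffOn.sum fun i _ ↦ (coordForm E i).contDiff.comp_contDiffOn
    (((hg.contDiffOn_riemann _).clm_apply contDiffOn_const).clm_apply contDiffOn_const)

theorem contDiffOn_metricTrace (hg : IsLocalMetric g U) {B : E → E →L[ℝ] E →L[ℝ] F}
    (hB : ContDiffOn ℝ ∞ B U) :
    ContDiffOn ℝ ∞ (fun y ↦ metricTrace (g y) fun u v ↦ B y u v) U :=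
  ContDiffOn.sum fun _ _ ↦ (hB.clm_apply contDiffOn_const).clm_apply
    (hg.contDiffOn_inverse.clm_apply contDiffOn_const)

theorem contDiffOn_scalarCurvature (hg : IsLocalMetric g U) :
    ContDiffOn ℝ ∞ (scalarCurvature g) U :=
  hg.contDiffOn_metricTrace hg.contDiffOn_ricci

theorem contDiffOn_schouten (hg : IsLocalMetric g U) : ContDiffOn ℝ ∞ (schouten g) U := by
  unfold schouten
  exact (hg.contDiffOn_ricci.sub
    ((hg.contDiffOn_scalarCurvature.div_const _).smul hg.contDiffOn)).const_smul _

theorem contDiffOn_schoutenTrace (hg : IsLocalMetric g U) :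
    ContDiffOn ℝ ∞ (schoutenTrace g) U :=
  hg.contDiffOn_metricTrace hg.contDiffOn_schouten

theorem fderiv_symm (hg : IsLocalMetric g U) (hy : y ∈ U) (e u v : E) :
    fderiv ℝ g y e u v = fderiv ℝ g y e v u := by
  have hd := hg.contDiffOn.differentiableAt_of_isOpen hg.isOpen hy
  rw [← fderiv_apply_apply_const hd, ← fderiv_apply_apply_const hd,
    fderiv_congr_on hg.isOpen hy fun z hz ↦ hg.symm z hz u v]

theorem christoffelLower_eq (hg : IsLocalMetric g U) (hy : y ∈ U) (u v w : E) :
    g y (christoffel g y u v) w = christoffelLower g y u v w := by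
  rw [christoffel_apply, (hg.isInvertible y hy).self_apply_inverse]

/-- The Levi-Civita connection is metric. -/
theorem fderiv_metric (hg : IsLocalMetric g U) (hy : y ∈ U) (u v w : E) :
    fderiv ℝ g y u v w = g y (christoffel g y u v) w + g y v (christoffel g y u w) := by
  rw [hg.symm y hy v, hg.christoffelLower_eq hy, hg.christoffelLower_eq hy,
    christoffelLower_apply, christoffelLower_apply, hg.fderiv_symm hy u w v]
  ring

/-- The Levi-Civita connection is torsion free. -/
theorem christoffel_symm (hg : IsLocalMetric g U) (hy : y ∈ U) (u v : E) :
    christoffel g y u v = christoffel g y v u := by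
  apply (hg.isInvertible y hy).injective
  ext w
  rw [hg.christoffelLower_eq hy, hg.christoffelLower_eq hy, christoffelLower_apply,
    christoffelLower_apply, hg.fderiv_symm hy w u v]
  ring

theorem fderiv_christoffel_symm (hg : IsLocalMetric g U) (hy : y ∈ U) (e u v : E) :
    fderiv ℝ (christoffel g) y e u v = fderiv ℝ (christoffel g) y e v u := by
  have hd := hg.contDiffOn_christoffel.differentiableAt_of_isOpen hg.isOpen hy
  rw [← fderiv_apply_apply_const hd, ← fderiv_apply_apply_const hd,
    fderiv_congr_on hg.isOpen hy fun z hz ↦ hg.christoffel_symm hz u v]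

theorem riemann_swap (g : E → E →L[ℝ] E →L[ℝ] ℝ) (y u v w : E) :
    riemann g y u v w = -riemann g y v u w := by
  simp only [riemann_apply]
  abel

/-- The first Bianchi identity. -/
theorem riemann_cyclic (hg : IsLocalMetric g U) (hy : y ∈ U) (u v w : E) :
    riemann g y u v w + riemann g y v w u + riemann g y w u v = 0 := by
  simp only [riemann_apply]
  rw [hg.fderiv_christoffel_symm hy u v w, hg.fderiv_christoffel_symm hy v u w,
    hg.fderiv_christoffel_symm hy w u v, hg.christoffel_symm hy v w, hg.christoffel_symm hy u w,
    hg.christoffel_symm hy v u]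
  abel

/-- The curvature is skew with respect to the metric. -/
theorem riemann_skew (hg : IsLocalMetric g U) (hy : y ∈ U) (u v w z : E) :
    g y (riemann g y u v w) z + g y w (riemann g y u v z) = 0 := by
  have hd := hg.contDiffOn.differentiableAt_of_isOpen hg.isOpen hy
  have hd' := (hg.contDiffOn.fderiv_infty hg.isOpen).differentiableAt_of_isOpen hg.isOpen hy
  have hΓ := hg.contDiffOn_christoffel.differentiableAt_of_isOpen hg.isOpen hy
  have hΓd : ∀ a b : E, DifferentiableAt ℝ (fun z ↦ christoffel g z a b) y := fun a b ↦
    (hΓ.clm_apply (differentiableAt_const a)).clm_apply (differentiableAt_const b)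
  -- Differentiate metric compatibility once more. Alternating in `a` and `b` removes the second
  -- derivative of `g` and leaves exactly the curvature terms.
  have key : ∀ a b : E, fderiv ℝ (fderiv ℝ g) y a b w z =
      fderiv ℝ g y a (christoffel g y b w) z + g y (fderiv ℝ (christoffel g) y a b w) z +
      (fderiv ℝ g y a w (christoffel g y b z) + g y w (fderiv ℝ (christoffel g) y a b z)) := by
    intro a b
    have h1 : fderiv ℝ (fun x ↦ fderiv ℝ g x b w z) y a = fderiv ℝ (fderiv ℝ g) y a b w z := by
      rw [fderiv_apply_apply_const (B := fun x ↦ fderiv ℝ g x b)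
        (hd'.clm_apply (differentiableAt_const b)),
        (hd'.hasFDerivAt.clm_apply (hasFDerivAt_const b y)).fderiv]
      simp
    rw [← h1, fderiv_congr_on hg.isOpen hy fun x hx ↦ hg.fderiv_metric hx b w z, fderiv_fun_add,
      add_apply, fderiv_apply_apply hd (hΓd _ _) (differentiableAt_const _),
      fderiv_apply_apply hd (differentiableAt_const _) (hΓd _ _),
      fderiv_apply_apply_const hΓ, fderiv_apply_apply_const hΓ]
    · simp
    · exact (hd.clm_apply (hΓd _ _)).clm_apply (differentiableAt_const _)
    · exact (hd.clm_apply (differentiableAt_const _)).clm_apply (hΓd _ _)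
  have hs := fderiv_fderiv_comm (hg.contDiffOn.contDiffAt (hg.isOpen.mem_nhds hy)) u v
  have hs' := congrArg (fun L : E →L[ℝ] E →L[ℝ] ℝ ↦ L w z) hs
  simp only [key, hg.fderiv_metric hy] at hs'
  simp only [riemann_apply, map_add, map_sub, add_apply,
    sub_apply]
  linarith

/-- An endomorphism that is skew for `g` is traceless: exchanging the slots of the contraction
changes its sign. -/
theorem trace_riemann (hg : IsLocalMetric g U) (hy : y ∈ U) (u v : E) :
    ∑ i, coordForm E i (riemann g y u v (Module.finBasis ℝ E i)) = 0 := by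
  have hb := hg.isInvertible y hy
  have h := metricTrace_comm hb (hg.symm y hy) (g y ∘L riemann g y u v)
  unfold metricTrace at h
  have h1 : ∀ i, (g y ∘L riemann g y u v) (Module.finBasis ℝ E i)
      ((g y).inverse (coordForm E i)) =
      coordForm E i (riemann g y u v (Module.finBasis ℝ E i)) := by
    intro i
    rw [← apply_inverse_coordForm hb i, hg.symm y hy]
    rfl
  have h2 : ∀ i, (g y ∘L riemann g y u v) ((g y).inverse (coordForm E i))
      (Module.finBasis ℝ E i) =
      -coordForm E i (riemann g y u v (Module.finBasis ℝ E i)) := by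
    intro i
    rw [← apply_inverse_coordForm hb i]
    exact eq_neg_of_add_eq_zero_left (hg.riemann_skew hy u v _ _)
  simp_rw [h1, h2, Finset.sum_neg_distrib] at h
  linarith

/-- Trace the first Bianchi identity: `R(v, w)` contributes nothing by `trace_riemann`, and the
other two terms are `Ric(v, w)` and `-Ric(w, v)`. -/
theorem ricci_symm (hg : IsLocalMetric g U) (hy : y ∈ U) (v w : E) :
    ricci g y v w = ricci g y w v := by
  rw [← sub_eq_zero, ricci_apply, ricci_apply, ← Finset.sum_sub_distrib, ← neg_eq_zero,
    ← hg.trace_riemann hy v w, ← Finset.sum_neg_distrib]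
  refine Finset.sum_congr rfl fun i _ ↦ ?_
  have h := congrArg (coordForm E i) (hg.riemann_cyclic hy (Module.finBasis ℝ E i) v w)
  rw [riemann_swap g y w] at h
  simp only [map_add, map_neg, map_zero] at h
  linarith

/-- The covariant derivative of a bilinear form. -/
noncomputable def covDerivForm (g : E → E →L[ℝ] E →L[ℝ] ℝ) (B : E → E →L[ℝ] E →L[ℝ] ℝ) (y e v w : E) : ℝ :=
  fderiv ℝ B y e v w - B y (christoffel g y e v) w - B y v (christoffel g y e w)

/-- The covariant derivative of the curvature. -/
noncomputable def covDerivRiemann (g : E → E →L[ℝ] E →L[ℝ] ℝ) (y e u v w : E) : E :=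
  fderiv ℝ (fun z ↦ riemann g z u) y e v w + christoffel g y e (riemann g y u v w)
    - riemann g y (christoffel g y e u) v w - riemann g y u (christoffel g y e v) w
    - riemann g y u v (christoffel g y e w)

theorem differentiableAt_christoffel (hg : IsLocalMetric g U) (hy : y ∈ U) :
    DifferentiableAt ℝ (christoffel g) y :=
  hg.contDiffOn_christoffel.differentiableAt_of_isOpen hg.isOpen hy

theorem differentiableAt_riemann (hg : IsLocalMetric g U) (hy : y ∈ U) (u : E) :
    DifferentiableAt ℝ (fun z ↦ riemann g z u) y :=
  (hg.contDiffOn_riemann u).differentiableAt_of_isOpen hg.isOpen hy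

/-- The first argument of `riemann` is not bundled as a linear one, yet the Ricci contraction is a
trace in that argument. -/
theorem riemann_add_left (g : E → E →L[ℝ] E →L[ℝ] ℝ) (y u u' v w : E) :
    riemann g y (u + u') v w = riemann g y u v w + riemann g y u' v w := by
  simp only [riemann_apply, map_add, add_apply]
  abel

theorem riemann_smul_left (g : E → E →L[ℝ] E →L[ℝ] ℝ) (y : E) (c : ℝ) (u v w : E) :
    riemann g y (c • u) v w = c • riemann g y u v w := by
  simp only [riemann_apply, map_smul, smul_apply]
  module

theorem covDerivRiemann_swap (hg : IsLocalMetric g U) (hy : y ∈ U) (e u v w : E) :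
    covDerivRiemann g y e u v w = -covDerivRiemann g y e v u w := by
  have h : fderiv ℝ (fun z ↦ riemann g z u) y e v w =
      -fderiv ℝ (fun z ↦ riemann g z v) y e u w := by
    rw [← fderiv_apply_apply_const (hg.differentiableAt_riemann hy u),
      ← fderiv_apply_apply_const (hg.differentiableAt_riemann hy v),
      fderiv_congr_on hg.isOpen hy fun z _ ↦ riemann_swap g z u v w, fderiv_fun_neg]
    rfl
  unfold covDerivRiemann
  rw [h, riemann_swap g y u v w, riemann_swap g y (christoffel g y e u) v,
    riemann_swap g y u (christoffel g y e v), riemann_swap g y u v (christoffel g y e w), map_neg]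
  abel

/-- Skewness of the curvature survives covariant differentiation because `g` is parallel; the
correction terms cancel by `riemann_skew` applied in each slot. -/
theorem covDerivRiemann_skew (hg : IsLocalMetric g U) (hy : y ∈ U) (e u v w z : E) :
    g y (covDerivRiemann g y e u v w) z + g y w (covDerivRiemann g y e u v z) = 0 := by
  have hd := hg.contDiffOn.differentiableAt_of_isOpen hg.isOpen hy
  have hR := hg.differentiableAt_riemann hy u
  have hRd : ∀ a b : E, DifferentiableAt ℝ (fun z ↦ riemann g z u a b) y := fun a b ↦
    (hR.clm_apply (differentiableAt_const a)).clm_apply (differentiableAt_const b)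
  have h := congrArg (fun L : E →L[ℝ] ℝ ↦ L e)
    (fderiv_congr_on hg.isOpen hy fun x hx ↦ hg.riemann_skew hx u v w z)
  rw [fderiv_fun_add ((hd.clm_apply (hRd _ _)).clm_apply (differentiableAt_const _))
    ((hd.clm_apply (differentiableAt_const _)).clm_apply (hRd _ _)), add_apply,
    fderiv_apply_apply hd (hRd _ _) (differentiableAt_const _),
    fderiv_apply_apply hd (differentiableAt_const _) (hRd _ _),
    fderiv_apply_apply_const hR, fderiv_apply_apply_const hR] at h
  simp only [hg.fderiv_metric hy, fderiv_fun_const, Pi.zero_apply, zero_apply,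
    map_zero, add_zero] at h
  have h1 := hg.riemann_skew hy (christoffel g y e u) v w z
  have h2 := hg.riemann_skew hy u (christoffel g y e v) w z
  have h3 := hg.riemann_skew hy u v (christoffel g y e w) z
  have h4 := hg.riemann_skew hy u v w (christoffel g y e z)
  unfold covDerivRiemann
  simp only [map_add, map_sub, add_apply, sub_apply]
  linarith

theorem fderiv_riemann (hg : IsLocalMetric g U) (hy : y ∈ U) (e u v w : E) :
    fderiv ℝ (fun z ↦ riemann g z u) y e v w =
      fderiv ℝ (fderiv ℝ (christoffel g)) y e u v w
      - fderiv ℝ (fderiv ℝ (christoffel g)) y e v u w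
      + (fderiv ℝ (christoffel g) y e u (christoffel g y v w)
        + christoffel g y u (fderiv ℝ (christoffel g) y e v w))
      - (fderiv ℝ (christoffel g) y e v (christoffel g y u w)
        + christoffel g y v (fderiv ℝ (christoffel g) y e u w)) := by
  have hΓ := hg.differentiableAt_christoffel hy
  have hΓ' := (hg.contDiffOn_christoffel.fderiv_infty hg.isOpen).differentiableAt_of_isOpen
    hg.isOpen hy
  have hΓd : ∀ a b : E, DifferentiableAt ℝ (fun z ↦ christoffel g z a b) y := fun a b ↦
    (hΓ.clm_apply (differentiableAt_const a)).clm_apply (differentiableAt_const b)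
  have hΓ'd : ∀ a : E, DifferentiableAt ℝ (fun z ↦ fderiv ℝ (christoffel g) z a) y := fun a ↦
    hΓ'.clm_apply (differentiableAt_const a)
  have h1 : ∀ a b, fderiv ℝ (fun x ↦ fderiv ℝ (christoffel g) x a b w) y e =
      fderiv ℝ (fderiv ℝ (christoffel g)) y e a b w := by
    intro a b
    rw [fderiv_apply_apply_const (B := fun x ↦ fderiv ℝ (christoffel g) x a) (hΓ'd a),
      (hΓ'.hasFDerivAt.clm_apply (hasFDerivAt_const a y)).fderiv]
    simp
  have h1d : ∀ a b, DifferentiableAt ℝ (fun x ↦ fderiv ℝ (christoffel g) x a b w) y :=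
    fun a b ↦ ((hΓ'd a).clm_apply (differentiableAt_const b)).clm_apply (differentiableAt_const w)
  have h2d : ∀ a b,
      DifferentiableAt ℝ (fun x ↦ christoffel g x a (christoffel g x b w)) y := fun a b ↦
    (hΓ.clm_apply (differentiableAt_const a)).clm_apply (hΓd b w)
  have h2 : ∀ a b, fderiv ℝ (fun x ↦ christoffel g x a (christoffel g x b w)) y e =
      fderiv ℝ (christoffel g) y e a (christoffel g y b w) +
        christoffel g y a (fderiv ℝ (christoffel g) y e b w) := by
    intro a b
    rw [fderiv_apply_apply hΓ (differentiableAt_const a) (hΓd b w), fderiv_apply_apply_const hΓ]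
    simp
  rw [← fderiv_apply_apply_const (hg.differentiableAt_riemann hy u)]
  simp_rw [riemann_apply]
  rw [fderiv_fun_sub (((h1d _ _).fun_sub (h1d _ _)).fun_add (h2d _ _)) (h2d _ _),
    fderiv_fun_add ((h1d _ _).fun_sub (h1d _ _)) (h2d _ _), fderiv_fun_sub (h1d _ _) (h1d _ _)]
  simp only [add_apply, sub_apply, h1, h2]

/-- The second Bianchi identity. -/
theorem covDerivRiemann_cyclic (hg : IsLocalMetric g U) (hy : y ∈ U) (e u v w : E) :
    covDerivRiemann g y e u v w + covDerivRiemann g y u v e w +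
      covDerivRiemann g y v e u w = 0 := by
  have hs : ∀ a b c, fderiv ℝ (fderiv ℝ (christoffel g)) y a b c w =
      fderiv ℝ (fderiv ℝ (christoffel g)) y b a c w := fun a b c ↦ by
    rw [fderiv_fderiv_comm (hg.contDiffOn_christoffel.contDiffAt (hg.isOpen.mem_nhds hy)) a b]
  -- In the cyclic sum the corrections in the two alternating slots cancel in pairs, such as `R(u,
  -- Γ(e, v))` with `R(Γ(v, e), u)`, since `R` alternates and `Γ` is symmetric.
  have h1 := riemann_swap g y u (christoffel g y e v) w
  have h2 := riemann_swap g y v (christoffel g y u e) w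
  have h3 := riemann_swap g y e (christoffel g y v u) w
  unfold covDerivRiemann
  rw [h1, h2, h3, hg.christoffel_symm hy v u, hg.christoffel_symm hy u e,
    hg.christoffel_symm hy e v, hg.fderiv_riemann hy, hg.fderiv_riemann hy, hg.fderiv_riemann hy,
    hs u e v, hs v e u, hs v u e]
  rw [riemann_apply g y e u (christoffel g y v w), riemann_apply g y v e (christoffel g y u w),
    riemann_apply g y u v (christoffel g y e w)]
  rw [riemann_apply g y e u w, riemann_apply g y v e w, riemann_apply g y u v w]
  simp only [map_add, map_sub]
  abel

theorem differentiableAt_ricci (hg : IsLocalMetric g U) (hy : y ∈ U) :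
    DifferentiableAt ℝ (ricci g) y :=
  hg.contDiffOn_ricci.differentiableAt_of_isOpen hg.isOpen hy

/-- The trace of the covariant derivative of the curvature. -/
theorem covDerivForm_ricci (hg : IsLocalMetric g U) (hy : y ∈ U) (e v w : E) :
    covDerivForm g (ricci g) y e v w =
      ∑ i, coordForm E i (covDerivRiemann g y e (Module.finBasis ℝ E i) v w) := by
  have h1 : fderiv ℝ (ricci g) y e v w =
      ∑ i, coordForm E i (fderiv ℝ (fun z ↦ riemann g z (Module.finBasis ℝ E i)) y e v w) := by
    have hR := fun i ↦ hg.differentiableAt_riemann hy (Module.finBasis ℝ E i)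
    have hRd : ∀ i, DifferentiableAt ℝ (fun z ↦ riemann g z (Module.finBasis ℝ E i) v w) y :=
      fun i ↦ ((hR i).clm_apply (differentiableAt_const v)).clm_apply (differentiableAt_const w)
    have hc : ∀ i, DifferentiableAt ℝ
        (fun z ↦ coordForm E i (riemann g z (Module.finBasis ℝ E i) v w)) y :=
      fun i ↦ (coordForm E i).differentiableAt.comp y (hRd i)
    rw [← fderiv_apply_apply_const (hg.differentiableAt_ricci hy)]
    simp_rw [ricci_apply]
    rw [fderiv_fun_sum fun i _ ↦ hc i]
    rw [sum_apply]
    refine Finset.sum_congr rfl fun i _ ↦ ?_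
    have hc' : HasFDerivAt
        (fun z ↦ coordForm E i (riemann g z (Module.finBasis ℝ E i) v w)) _ y :=
      (coordForm E i).hasFDerivAt.comp y (hRd i).hasFDerivAt
    rw [← fderiv_apply_apply_const (hR i), hc'.fderiv]
    rfl
  -- The corrections in the two contracted slots cancel because `tr (Γ T) = tr (T Γ)`.
  have h2 : ∑ i, coordForm E i (christoffel g y e (riemann g y (Module.finBasis ℝ E i) v w)) =
      ∑ i, coordForm E i (riemann g y (christoffel g y e (Module.finBasis ℝ E i)) v w) := by
    let T : E →L[ℝ] E := LinearMap.toContinuousLinearMap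
      { toFun := fun u ↦ riemann g y u v w
        map_add' := fun a b ↦ riemann_add_left g y a b v w
        map_smul' := fun c a ↦ riemann_smul_left g y c a v w }
    exact sum_coordForm_comp_comm (christoffel g y e) T
  unfold covDerivForm covDerivRiemann
  simp only [map_add, map_sub, Finset.sum_add_distrib, Finset.sum_sub_distrib]
  rw [h1, h2, ricci_apply, ricci_apply]
  ring

/-- The derivative of a metric trace is the trace of the covariant derivative. -/
theorem fderiv_metricTrace (hg : IsLocalMetric g U) (hy : y ∈ U) {B : E → E →L[ℝ] E →L[ℝ] ℝ}
    (hB : DifferentiableAt ℝ B y) (e : E) :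
    fderiv ℝ (fun z ↦ metricTrace (g z) fun u v ↦ B z u v) y e =
      metricTrace (g y) (covDerivForm g B y e) := by
  have hb := hg.isInvertible y hy
  have hinv := hg.contDiffOn_inverse.differentiableAt_of_isOpen hg.isOpen hy
  have hG : ∀ i, DifferentiableAt ℝ (fun z ↦ (g z).inverse (coordForm E i)) y := fun i ↦
    hinv.clm_apply (differentiableAt_const _)
  have hd := hg.contDiffOn.differentiableAt_of_isOpen hg.isOpen hy
  -- Obtained by differentiating the defining relation `g(g⁻¹ eⁱ, v) = eⁱ(v)`: the inverse metric is
  -- parallel too.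
  have hGd : ∀ i, fderiv ℝ (fun z ↦ (g z).inverse (coordForm E i)) y e =
      -christoffel g y e ((g y).inverse (coordForm E i)) -
        (g y).inverse (coordForm E i ∘L christoffel g y e) := by
    intro i
    apply hb.injective
    ext v
    have h := congrArg (fun L : E →L[ℝ] ℝ ↦ L e) (fderiv_congr_on hg.isOpen hy fun x hx ↦
      apply_inverse_coordForm (hg.isInvertible x hx) i v)
    rw [fderiv_apply_apply hd (hG i) (differentiableAt_const v)] at h
    simp only [hg.fderiv_metric hy, fderiv_fun_const, Pi.zero_apply, zero_apply, map_zero,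
      add_zero, apply_inverse_coordForm hb] at h
    simp only [map_sub, map_neg, sub_apply, neg_apply, hb.self_apply_inverse,
      ContinuousLinearMap.comp_apply]
    linarith
  have ht : ∑ i, B y (Module.finBasis ℝ E i)
      ((g y).inverse (coordForm E i ∘L christoffel g y e)) =
      ∑ i, B y (christoffel g y e (Module.finBasis ℝ E i)) ((g y).inverse (coordForm E i)) :=
    sum_transpose (((ContinuousLinearMap.compL ℝ _ E ℝ).flip (g y).inverse) ∘L B y)
      (christoffel g y e)
  unfold metricTrace covDerivForm
  rw [fderiv_fun_sum fun i _ ↦ (hB.clm_apply (differentiableAt_const _)).clm_apply (hG i),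
    sum_apply]
  simp_rw [fderiv_apply_apply hB (differentiableAt_const _) (hG _), hGd]
  simp only [fderiv_fun_const, Pi.zero_apply, zero_apply, map_zero, add_zero, map_sub, map_neg,
    Finset.sum_add_distrib, Finset.sum_sub_distrib, Finset.sum_neg_distrib, ht]
  ring

/-- The twice contracted second Bianchi identity: the divergence of the Ricci curvature is half the
derivative of the scalar curvature. -/
theorem divergence_ricci (hg : IsLocalMetric g U) (hy : y ∈ U) (u : E) :
    2 * metricTrace (g y) (fun v w ↦ covDerivForm g (ricci g) y v u w) =
      fderiv ℝ (scalarCurvature g) y u := by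
  have hb := hg.isInvertible y hy
  -- Contract the second Bianchi identity twice. Two of the three terms become the divergence of
  -- `Ric`, the remaining one `-dSc`.
  have h : ∑ j, ∑ i, coordForm E i
      (covDerivRiemann g y (Module.finBasis ℝ E i) u (Module.finBasis ℝ E j)
          ((g y).inverse (coordForm E j)) +
        covDerivRiemann g y u (Module.finBasis ℝ E j) (Module.finBasis ℝ E i)
          ((g y).inverse (coordForm E j)) +
        covDerivRiemann g y (Module.finBasis ℝ E j) (Module.finBasis ℝ E i) u
          ((g y).inverse (coordForm E j))) = 0 := by
    simp [hg.covDerivRiemann_cyclic hy]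
  simp only [map_add, Finset.sum_add_distrib] at h
  have h1 : ∑ j, ∑ i, coordForm E i (covDerivRiemann g y (Module.finBasis ℝ E i) u
      (Module.finBasis ℝ E j) ((g y).inverse (coordForm E j))) =
      metricTrace (g y) (fun v w ↦ covDerivForm g (ricci g) y v u w) := by
    unfold metricTrace
    simp_rw [hg.covDerivForm_ricci hy]
    rw [Finset.sum_comm]
    refine Finset.sum_congr rfl fun i _ ↦ Finset.sum_congr rfl fun j _ ↦ ?_
    -- Alternation in the first pair of slots and skewness in the second exchange the two
    -- contractions, so pair symmetry of the curvature is not needed.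
    rw [← apply_inverse_coordForm hb i, ← apply_inverse_coordForm hb j,
      hg.covDerivRiemann_swap hy _ u, hg.symm y hy, map_neg, neg_apply]
    have := hg.covDerivRiemann_skew hy (Module.finBasis ℝ E i) (Module.finBasis ℝ E j) u
      ((g y).inverse (coordForm E j)) ((g y).inverse (coordForm E i))
    linarith
  have h2 : ∑ j, ∑ i, coordForm E i (covDerivRiemann g y u (Module.finBasis ℝ E j)
      (Module.finBasis ℝ E i) ((g y).inverse (coordForm E j))) =
      -fderiv ℝ (scalarCurvature g) y u := by
    have h3 : fderiv ℝ (scalarCurvature g) y u = _ :=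
      hg.fderiv_metricTrace hy (hg.differentiableAt_ricci hy) u
    rw [h3]
    unfold metricTrace
    simp_rw [hg.covDerivForm_ricci hy]
    rw [← Finset.sum_neg_distrib]
    refine Finset.sum_congr rfl fun j _ ↦ ?_
    rw [← Finset.sum_neg_distrib]
    refine Finset.sum_congr rfl fun i _ ↦ ?_
    rw [hg.covDerivRiemann_swap hy, map_neg]
  have h3 : ∑ j, ∑ i, coordForm E i (covDerivRiemann g y (Module.finBasis ℝ E j)
      (Module.finBasis ℝ E i) u ((g y).inverse (coordForm E j))) =
      metricTrace (g y) (fun v w ↦ covDerivForm g (ricci g) y v u w) := by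
    unfold metricTrace
    simp_rw [hg.covDerivForm_ricci hy]
  linarith

end IsLocalMetric

end LocalMetric

/-! ### The Schouten tensor and its divergence -/

section Schouten

variable {E : Type*} [NormedAddCommGroup E] [NormedSpace ℝ E] [FiniteDimensional ℝ E]
  {g : E → E →L[ℝ] E →L[ℝ] ℝ} {U : Set E} {y : E}

namespace IsLocalMetric

theorem schouten_apply (g : E → E →L[ℝ] E →L[ℝ] ℝ) (y u v : E) :
    schouten g y u v = ((Module.finrank ℝ E : ℝ) - 2)⁻¹ *
      (ricci g y u v -
        scalarCurvature g y / (2 * ((Module.finrank ℝ E : ℝ) - 1)) * g y u v) := by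
  simp [schouten]

theorem schouten_symm (hg : IsLocalMetric g U) (hy : y ∈ U) (u v : E) :
    schouten g y u v = schouten g y v u := by
  rw [schouten_apply, schouten_apply, hg.symm y hy u v, hg.ricci_symm hy u v]

theorem schoutenTrace_eq (hg : IsLocalMetric g U) (hy : y ∈ U)
    (hn : 2 < Module.finrank ℝ E) :
    schoutenTrace g y = scalarCurvature g y / (2 * ((Module.finrank ℝ E : ℝ) - 1)) := by
  have hn' : (2 : ℝ) < Module.finrank ℝ E := by exact_mod_cast hn
  have h1 : (Module.finrank ℝ E : ℝ) - 1 ≠ 0 := by linarith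
  have h2 : (Module.finrank ℝ E : ℝ) - 2 ≠ 0 := by linarith
  have ht : metricTrace (g y) (fun u v ↦ g y u v) = Module.finrank ℝ E :=
    metricTrace_self (hg.isInvertible y hy) (hg.symm y hy)
  have h : schoutenTrace g y = ((Module.finrank ℝ E : ℝ) - 2)⁻¹ *
      (scalarCurvature g y - scalarCurvature g y / (2 * ((Module.finrank ℝ E : ℝ) - 1)) *
        metricTrace (g y) (fun u v ↦ g y u v)) := by
    conv_rhs => enter [2, 1]; unfold scalarCurvature
    unfold schoutenTrace
    simp only [metricTrace, schouten_apply, Finset.mul_sum, mul_sub, Finset.sum_sub_distrib]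
  rw [h, ht]
  field_simp
  ring

theorem differentiableAt_scalarCurvature (hg : IsLocalMetric g U) (hy : y ∈ U) :
    DifferentiableAt ℝ (scalarCurvature g) y :=
  hg.contDiffOn_scalarCurvature.differentiableAt_of_isOpen hg.isOpen hy

theorem differentiableAt_schouten (hg : IsLocalMetric g U) (hy : y ∈ U) :
    DifferentiableAt ℝ (schouten g) y :=
  hg.contDiffOn_schouten.differentiableAt_of_isOpen hg.isOpen hy

theorem differentiableAt_schoutenTrace (hg : IsLocalMetric g U) (hy : y ∈ U) :
    DifferentiableAt ℝ (schoutenTrace g) y :=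
  hg.contDiffOn_schoutenTrace.differentiableAt_of_isOpen hg.isOpen hy

theorem differentiableAt (hg : IsLocalMetric g U) (hy : y ∈ U) : DifferentiableAt ℝ g y :=
  hg.contDiffOn.differentiableAt_of_isOpen hg.isOpen hy

/-- Since `g` is parallel, only the scalar coefficient of the metric term is differentiated. -/
theorem covDerivForm_schouten (hg : IsLocalMetric g U) (hy : y ∈ U) (e u v : E) :
    covDerivForm g (schouten g) y e u v = ((Module.finrank ℝ E : ℝ) - 2)⁻¹ *
      (covDerivForm g (ricci g) y e u v -
        fderiv ℝ (scalarCurvature g) y e / (2 * ((Module.finrank ℝ E : ℝ) - 1)) * g y u v) := by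
  have hS := hg.differentiableAt_scalarCurvature hy
  have hR := hg.differentiableAt_ricci hy
  have hd := hg.differentiableAt hy
  have h : fderiv ℝ (schouten g) y e u v = ((Module.finrank ℝ E : ℝ) - 2)⁻¹ *
      (fderiv ℝ (ricci g) y e u v -
        (fderiv ℝ (scalarCurvature g) y e / (2 * ((Module.finrank ℝ E : ℝ) - 1)) * g y u v
        + scalarCurvature g y / (2 * ((Module.finrank ℝ E : ℝ) - 1)) *
          fderiv ℝ g y e u v)) := by
    have hder : HasFDerivAt (schouten g) _ y :=
      (hR.hasFDerivAt.sub ((hS.hasFDerivAt.mul_const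
        ((2 * ((Module.finrank ℝ E : ℝ) - 1))⁻¹)).smul hd.hasFDerivAt)).const_smul
          ((Module.finrank ℝ E : ℝ) - 2)⁻¹
    rw [hder.fderiv]
    simp only [smul_apply, sub_apply, add_apply, ContinuousLinearMap.smulRight_apply, smul_eq_mul]
    ring
  unfold covDerivForm
  rw [h, schouten_apply, schouten_apply, hg.fderiv_metric hy]
  ring

/-- The divergence of the Schouten tensor is the derivative of its trace. -/
theorem divergence_schouten (hg : IsLocalMetric g U) (hy : y ∈ U) (hn : 2 < Module.finrank ℝ E)
    (u : E) :
    metricTrace (g y) (fun v w ↦ covDerivForm g (schouten g) y v u w) =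
      fderiv ℝ (schoutenTrace g) y u := by
  have hn' : (2 : ℝ) < Module.finrank ℝ E := by exact_mod_cast hn
  have h1 : (Module.finrank ℝ E : ℝ) - 1 ≠ 0 := by linarith
  have h2 : (Module.finrank ℝ E : ℝ) - 2 ≠ 0 := by linarith
  have hb := hg.isInvertible y hy
  have hJ : fderiv ℝ (schoutenTrace g) y u =
      fderiv ℝ (scalarCurvature g) y u / (2 * ((Module.finrank ℝ E : ℝ) - 1)) := by
    rw [fderiv_congr_on hg.isOpen hy fun z hz ↦ hg.schoutenTrace_eq hz hn]
    simp_rw [div_eq_mul_inv]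
    rw [((hg.differentiableAt_scalarCurvature hy).hasFDerivAt.mul_const _).fderiv]
    simp [mul_comm]
  have hg1 : ∑ i, fderiv ℝ (scalarCurvature g) y (Module.finBasis ℝ E i) *
      g y u ((g y).inverse (coordForm E i)) = fderiv ℝ (scalarCurvature g) y u := by
    conv_rhs => rw [← sum_coordForm_smul u]
    simp_rw [hg.symm y hy u, apply_inverse_coordForm hb]
    simp [mul_comm]
  -- The coefficients combine as `(1/2 - 1/(2(n-1))) / (n-2) = 1/(2(n-1))`, which is the factor
  -- relating `dJ` to `dSc`.
  have hdiv := hg.divergence_ricci hy u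
  unfold metricTrace at hdiv ⊢
  simp_rw [hg.covDerivForm_schouten hy]
  rw [← Finset.mul_sum, Finset.sum_sub_distrib]
  simp_rw [div_mul_eq_mul_div]
  rw [← Finset.sum_div, hg1, hJ, ← hdiv]
  field_simp
  ring

theorem covDerivForm_schouten_symm (hg : IsLocalMetric g U) (hy : y ∈ U) (e u v : E) :
    covDerivForm g (schouten g) y e u v = covDerivForm g (schouten g) y e v u := by
  have hd := hg.differentiableAt_schouten hy
  unfold covDerivForm
  rw [← fderiv_apply_apply_const hd, ← fderiv_apply_apply_const hd,
    fderiv_congr_on hg.isOpen hy fun z hz ↦ hg.schouten_symm hz u v,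
    hg.schouten_symm hy _ v, hg.schouten_symm hy u]
  ring

end IsLocalMetric

end Schouten

/-! ### Tractor derivatives of the squared scale -/

section ScaleTractor

variable {E : Type*} [NormedAddCommGroup E] [NormedSpace ℝ E] [FiniteDimensional ℝ E]
  {g : E → E →L[ℝ] E →L[ℝ] ℝ} {U : Set E} {y : E}

/-- In its own scale the density is constant, so only the zeroth-order terms of `D` survive, with
`(n + 2w - 2) w = 2(n+2)` at `w = 2`. As cotractors, `coeffX` is `Y` and `coeffY` is `X`. -/
theorem densityD_scaleSq (g : E → E →L[ℝ] E →L[ℝ] ℝ) :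
    densityD g 2 (scaleSq g) = fun y ↦
      (2 * ((Module.finrank ℝ E : ℝ) + 2)) • Tractor.coeffX E -
        (2 * schoutenTrace g y) • Tractor.coeffY E := by
  have h0 : covDeriv (fun _ ↦ 0) (scaleSq g) = 0 := by
    ext y v
    have h : fderiv ℝ (scaleSq g) y = 0 := fderiv_const_apply 1
    simp [covDeriv, h]
  ext1 y
  apply ContinuousLinearMap.ext
  intro t
  simp only [densityD, tractorD, coupledLaplacian, h0, scaleSq, metricTrace]
  simp
  ring

theorem densityD_scaleSq_apply (g : E → E →L[ℝ] E →L[ℝ] ℝ) (y : E) (t : Tractor E) :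
    densityD g 2 (scaleSq g) y t =
      2 * ((Module.finrank ℝ E : ℝ) + 2) * t.1 - 2 * schoutenTrace g y * t.2.2 := by
  rw [densityD_scaleSq]
  simp [Tractor.coeffX, Tractor.coeffY]

theorem cotractorConnection_apply (g : E → E →L[ℝ] E →L[ℝ] ℝ) (y v : E) (φ : Tractor E →L[ℝ] ℝ)
    (t : Tractor E) :
    cotractorConnection g y v φ t = -φ (-schouten g y v t.2.1,
        t.1 • v + christoffel g y v t.2.1 + t.2.2 • (g y).inverse (schouten g y v),
        -g y v t.2.1) := by
  simp [cotractorConnection, tractorConnection]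

namespace IsLocalMetric

/-- From `∇Y = P` and `∇X = Z` applied to `2(n+2) Y - 2J X`. There is no `Z` component, hence no
Christoffel term, and the `Y` component has a constant coefficient. -/
theorem covDeriv_densityD (hg : IsLocalMetric g U) (hy : y ∈ U) (v : E) (t : Tractor E) :
    covDeriv (cotractorConnection g) (densityD g 2 (scaleSq g)) y v t =
      2 * ((Module.finrank ℝ E : ℝ) + 2) * schouten g y v t.2.1
        - 2 * schoutenTrace g y * g y v t.2.1
        - 2 * fderiv ℝ (schoutenTrace g) y v * t.2.2 := by
  have hJ := (hg.differentiableAt_schoutenTrace hy).hasFDerivAt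
  have h1 : fderiv ℝ (densityD g 2 (scaleSq g)) y v t =
      -(2 * fderiv ℝ (schoutenTrace g) y v * t.2.2) := by
    have h : HasFDerivAt (densityD g 2 (scaleSq g))
        (-((2 : ℝ) • fderiv ℝ (schoutenTrace g) y).smulRight (Tractor.coeffY E)) y := by
      rw [densityD_scaleSq]
      have h2 : HasFDerivAt (fun z ↦ 2 * schoutenTrace g z)
          ((2 : ℝ) • fderiv ℝ (schoutenTrace g) y) y := hJ.const_mul 2
      exact (h2.smul_const (Tractor.coeffY E)).const_sub
        ((2 * ((Module.finrank ℝ E : ℝ) + 2)) • Tractor.coeffX E)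
    rw [h.fderiv]
    simp [Tractor.coeffY]
  unfold covDeriv
  rw [add_apply, add_apply, h1, ContinuousLinearMap.flip_apply, cotractorConnection_apply,
    densityD_scaleSq_apply]
  ring

theorem contDiffOn_covDeriv_densityD (hg : IsLocalMetric g U) :
    ContDiffOn ℝ ∞ (covDeriv (cotractorConnection g) (densityD g 2 (scaleSq g))) U := by
  rw [contDiffOn_clm_apply]
  intro v
  rw [contDiffOn_clm_apply]
  intro t
  refine ContDiffOn.congr ?_ fun y hy ↦ hg.covDeriv_densityD hy v t
  have hJ := hg.contDiffOn_schoutenTrace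
  exact ((contDiffOn_const.mul ((hg.contDiffOn_schouten.clm_apply contDiffOn_const).clm_apply
    contDiffOn_const)).sub ((contDiffOn_const.mul hJ).mul
      ((hg.contDiffOn.clm_apply contDiffOn_const).clm_apply contDiffOn_const))).sub
      ((contDiffOn_const.mul ((hJ.fderiv_infty hg.isOpen).clm_apply contDiffOn_const)).mul
        contDiffOn_const)

/-- The components along `X` and `Z` of the Laplacian of the scale tractor. -/
theorem coupledLaplacian_densityD (hg : IsLocalMetric g U) (hy : y ∈ U)
    (hn : 2 < Module.finrank ℝ E) (σ : ℝ) (μ : E) :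
    coupledLaplacian g (cotractorConnection g) (densityD g 2 (scaleSq g)) y (σ, μ, 0) =
      -4 * schoutenTrace g y * σ +
        2 * (Module.finrank ℝ E : ℝ) * fderiv ℝ (schoutenTrace g) y μ := by
  have hb := hg.isInvertible y hy
  have hJ := hg.differentiableAt_schoutenTrace hy
  have hP := hg.differentiableAt_schouten hy
  have hd := hg.differentiableAt hy
  have hW := hg.contDiffOn_covDeriv_densityD.differentiableAt_of_isOpen hg.isOpen hy
  have h1 : ∀ e v : E, fderiv ℝ (covDeriv (cotractorConnection g) (densityD g 2 (scaleSq g))) y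
      e v (σ, μ, 0) = 2 * ((Module.finrank ℝ E : ℝ) + 2) * fderiv ℝ (schouten g) y e v μ
        - (2 * fderiv ℝ (schoutenTrace g) y e * g y v μ +
          2 * schoutenTrace g y * fderiv ℝ g y e v μ) := by
    intro e v
    rw [← fderiv_apply_apply_const hW,
      fderiv_congr_on hg.isOpen hy fun z hz ↦ hg.covDeriv_densityD hz v (σ, μ, 0),
      ← fderiv_apply_apply_const hP, ← fderiv_apply_apply_const hd]
    have hPd : DifferentiableAt ℝ (fun z ↦ schouten g z v μ) y :=
      (hP.clm_apply (differentiableAt_const v)).clm_apply (differentiableAt_const μ)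
    have hgd : DifferentiableAt ℝ (fun z ↦ g z v μ) y :=
      (hd.clm_apply (differentiableAt_const v)).clm_apply (differentiableAt_const μ)
    have h : HasFDerivAt (fun z ↦ 2 * ((Module.finrank ℝ E : ℝ) + 2) * schouten g z v μ
        - 2 * schoutenTrace g z * g z v μ) _ y :=
      (hPd.hasFDerivAt.const_mul (2 * ((Module.finrank ℝ E : ℝ) + 2))).sub
        ((hJ.hasFDerivAt.const_mul 2).mul hgd.hasFDerivAt)
    simp only [mul_zero, sub_zero]
    rw [h.fderiv]
    simp
    ring
  -- Before tracing, all Christoffel terms are absorbed into the covariant derivative of `P`.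
  -- Testing only on `(σ, μ, 0)` avoids the second derivatives of `J`.
  have h2 : ∀ e v : E, fderiv ℝ (covDeriv (cotractorConnection g) (densityD g 2 (scaleSq g))) y
        e v (σ, μ, 0)
      + cotractorConnection g y e
        (covDeriv (cotractorConnection g) (densityD g 2 (scaleSq g)) y v) (σ, μ, 0)
      - covDeriv (cotractorConnection g) (densityD g 2 (scaleSq g)) y
        (christoffel g y e v) (σ, μ, 0) =
      2 * ((Module.finrank ℝ E : ℝ) + 2) * covDerivForm g (schouten g) y e μ v
        - 2 * ((Module.finrank ℝ E : ℝ) + 2) * σ * schouten g y e v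
        + 2 * schoutenTrace g y * σ * g y e v
        - 2 * (fderiv ℝ (schoutenTrace g) y e * g y v μ)
        - 2 * (fderiv ℝ (schoutenTrace g) y v * g y e μ) := by
    intro e v
    rw [h1, cotractorConnection_apply, hg.covDeriv_densityD hy, hg.covDeriv_densityD hy,
      hg.covDerivForm_schouten_symm hy, hg.schouten_symm hy e v, hg.symm y hy e v,
      hg.fderiv_metric hy]
    simp only [covDerivForm, map_add, map_smul, smul_eq_mul, zero_smul, add_zero]
    ring
  have hg1 : ∑ i, fderiv ℝ (schoutenTrace g) y (Module.finBasis ℝ E i) *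
      g y ((g y).inverse (coordForm E i)) μ = fderiv ℝ (schoutenTrace g) y μ := by
    conv_rhs => rw [← sum_coordForm_smul μ]
    simp_rw [apply_inverse_coordForm hb]
    simp [mul_comm]
  have hg2 : ∑ i, fderiv ℝ (schoutenTrace g) y ((g y).inverse (coordForm E i)) *
      g y (Module.finBasis ℝ E i) μ = fderiv ℝ (schoutenTrace g) y μ := by
    conv_rhs => rw [← hb.inverse_apply_self μ, ← sum_smul_inverse_coordForm]
    simp_rw [hg.symm y hy _ μ]
    simp [mul_comm]
  have hg3 : ∑ i, g y (Module.finBasis ℝ E i) ((g y).inverse (coordForm E i)) =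
      Module.finrank ℝ E := metricTrace_self hb (hg.symm y hy)
  -- The divergence of `P` contributes `2(n+2) dJ`; the two mixed terms subtract `4 dJ`, which
  -- leaves `2n dJ`.
  have hg4 := hg.divergence_schouten hy hn μ
  unfold metricTrace at hg4
  have hg5 : ∑ i, schouten g y (Module.finBasis ℝ E i) ((g y).inverse (coordForm E i)) =
      schoutenTrace g y := rfl
  unfold coupledLaplacian metricTrace
  rw [sum_apply]
  simp only [add_apply, sub_apply, h2, Finset.sum_add_distrib, Finset.sum_sub_distrib,
    ← Finset.mul_sum, hg1, hg2, hg3, hg4, hg5]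
  ring

/-- The outer operator acts on weight one, where `(n + 2w - 2) w` and `n + 2w - 2` both equal `n`.
-/
theorem densityD2_apply (hg : IsLocalMetric g U) (hy : y ∈ U) (s t : Tractor E) :
    densityD2 g 2 (scaleSq g) y s t = (Module.finrank ℝ E : ℝ) *
        (s.1 * (2 * ((Module.finrank ℝ E : ℝ) + 2) * t.1 - 2 * schoutenTrace g y * t.2.2)
        + (2 * ((Module.finrank ℝ E : ℝ) + 2) * schouten g y s.2.1 t.2.1
          - 2 * schoutenTrace g y * g y s.2.1 t.2.1
          - 2 * fderiv ℝ (schoutenTrace g) y s.2.1 * t.2.2))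
      - s.2.2 * (coupledLaplacian g (cotractorConnection g) (densityD g 2 (scaleSq g)) y t +
        schoutenTrace g y *
          (2 * ((Module.finrank ℝ E : ℝ) + 2) * t.1 - 2 * schoutenTrace g y * t.2.2)) := by
  unfold densityD2 tractorD
  simp only [add_apply, sub_apply, smul_apply, ContinuousLinearMap.smulRight_apply,
    ContinuousLinearMap.comp_apply, hg.covDeriv_densityD hy, densityD_scaleSq_apply, smul_eq_mul,
    Tractor.coeffX, Tractor.coeffY, Tractor.coeffZ, ContinuousLinearMap.coe_fst',
    ContinuousLinearMap.coe_snd']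
  ring

/-- The components of the second tractor `D`-derivative of the squared scale. -/
theorem exists_densityD2_apply (hg : IsLocalMetric g U) (hy : y ∈ U)
    (hn : 2 < Module.finrank ℝ E) :
    ∃ c : ℝ, ∀ s t : Tractor E, densityD2 g 2 (scaleSq g) y s t = (Module.finrank ℝ E : ℝ) *
        (2 * ((Module.finrank ℝ E : ℝ) + 2) * (s.1 * t.1)
        - 2 * schoutenTrace g y * (s.1 * t.2.2 + s.2.2 * t.1)
        + 2 * ((Module.finrank ℝ E : ℝ) + 2) * schouten g y s.2.1 t.2.1
        - 2 * schoutenTrace g y * g y s.2.1 t.2.1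
        - 2 * fderiv ℝ (schoutenTrace g) y s.2.1 * t.2.2
        - 2 * fderiv ℝ (schoutenTrace g) y t.2.1 * s.2.2) + c * (s.2.2 * t.2.2) := by
  -- The constant is the value on `(Y, Y)`. It can stay unevaluated: it affects neither the
  -- symmetry, nor the trace, nor the contraction with `X`.
  refine ⟨-(coupledLaplacian g (cotractorConnection g) (densityD g 2 (scaleSq g)) y (0, 0, 1) -
    2 * schoutenTrace g y ^ 2), fun s t ↦ ?_⟩
  have ht : t = (t.1, t.2.1, 0) + t.2.2 • ((0, 0, 1) : Tractor E) := by
    ext <;> simp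
  have hL : coupledLaplacian g (cotractorConnection g) (densityD g 2 (scaleSq g)) y t =
      -4 * schoutenTrace g y * t.1 +
        2 * (Module.finrank ℝ E : ℝ) * fderiv ℝ (schoutenTrace g) y t.2.1 + t.2.2 *
        coupledLaplacian g (cotractorConnection g) (densityD g 2 (scaleSq g)) y (0, 0, 1) := by
    conv_lhs => rw [ht]
    rw [map_add, hg.coupledLaplacian_densityD hy hn, map_smul, smul_eq_mul]
  -- Here symmetry emerges: the coefficient of `s.2.2 * t.1` is `4J - 2(n+2)J = -2nJ`, the same as
  -- that of `s.1 * t.2.2`, and both mixed `dJ` coefficients are `-2n`.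
  rw [hg.densityD2_apply hy, hL]
  ring

end IsLocalMetric

end ScaleTractor

/-! ### Tractor derivatives on the projective null cone -/

section FlatModel

variable {V : Type*} [NormedAddCommGroup V] [NormedSpace ℝ V] [FiniteDimensional ℝ V]
  {F : Type*} [NormedAddCommGroup F] [NormedSpace ℝ F]

omit [FiniteDimensional ℝ V] in
theorem fderiv_quadricScaleSq {q : V →L[ℝ] V →L[ℝ] ℝ} (hq : ∀ s t, q s t = q t s) :
    fderiv ℝ (quadricScaleSq q) = ⇑((2 : ℝ) • q) := by
  ext v a
  have h : HasFDerivAt (quadricScaleSq q) _ v :=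
    q.hasFDerivAt.clm_apply (hasFDerivAt_id (𝕜 := ℝ) v)
  rw [h.fderiv]
  simp [hq a v, two_mul]

theorem flatLaplacian_clm (k : V →L[ℝ] V →L[ℝ] ℝ) (L : V →L[ℝ] F) (v : V) :
    flatLaplacian k L v = 0 := by
  have h : fderiv ℝ (⇑L) = fun _ ↦ L := funext fun _ ↦ L.fderiv
  simp [flatLaplacian, metricTrace, h]

/-- For a quadratic function the differential is `2q(v, ·)` and the Laplacian is the constant `2 tr
q`; at weight two the leading factor is `dim V`. -/
theorem modelD_quadricScaleSq (k : V →L[ℝ] V →L[ℝ] ℝ) {q : V →L[ℝ] V →L[ℝ] ℝ}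
    (hq : ∀ s t, q s t = q t s) :
    modelD k 2 (quadricScaleSq q) = ⇑((2 * (Module.finrank ℝ V : ℝ)) • q -
      (2 * metricTrace k fun s t ↦ q s t) • k) := by
  have h : flatLaplacian k (quadricScaleSq q) = fun _ ↦ 2 * metricTrace k fun s t ↦ q s t := by
    ext v
    rw [flatLaplacian, fderiv_quadricScaleSq hq, ContinuousLinearMap.fderiv]
    simp [metricTrace, Finset.mul_sum]
  ext v a
  simp only [modelD, h, fderiv_quadricScaleSq hq]
  simp
  ring

/-- The inner derivative is linear in `v`, so the outer Laplacian vanishes. For `k` symmetric and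
invertible, `tr k = dim V`, and the result is a multiple of the trace-free part of `q`. -/
theorem modelD2_quadricScaleSq (k : V →L[ℝ] V →L[ℝ] ℝ) {q : V →L[ℝ] V →L[ℝ] ℝ}
    (hq : ∀ s t, q s t = q t s) (v : V) :
    modelD2 k 2 (quadricScaleSq q) v =
      ((Module.finrank ℝ V : ℝ) - 2) • ((2 * (Module.finrank ℝ V : ℝ)) • q -
        (2 * metricTrace k fun s t ↦ q s t) • k) := by
  rw [modelD2, modelD_quadricScaleSq k hq, modelD, flatLaplacian_clm, ContinuousLinearMap.fderiv]
  have h : (Module.finrank ℝ V : ℝ) - 2 + 2 * (2 - 1) - 2 = (Module.finrank ℝ V : ℝ) - 2 := by ring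
  rw [h, ContinuousLinearMap.smulRight_zero, sub_zero]

/-- A metric trace in terms of an arbitrary basis. -/
theorem metricTrace_eq_sum {ι : Type*} [Fintype ι] {k : V →L[ℝ] V →L[ℝ] ℝ} (hk : k.IsInvertible)
    (hs : ∀ s t, k s t = k t s) (B : V →L[ℝ] V →L[ℝ] ℝ) (b : Module.Basis ι ℝ V) (b' : ι → V)
    (hb : ∀ i v, k (b' i) v = b.repr v i) :
    metricTrace k (fun s t ↦ B s t) = ∑ i, B (b i) (b' i) := by
  classical
  rw [metricTrace_eq_trace hk hs, LinearMap.trace_eq_matrix_trace ℝ b, Matrix.trace]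
  refine Finset.sum_congr rfl fun i _ ↦ ?_
  rw [Matrix.diag_apply, LinearMap.toMatrix_apply, ← hb, hs]
  simp [hk.self_apply_inverse]

/-- Forms that differ by a multiple of `k` define the same metric on the null cone of `k`. -/
theorem quadricCosmology_congr {k q q' : V →L[ℝ] V →L[ℝ] ℝ} {c : ℝ} (h : q = q' + c • k) :
    quadricCosmology k q = quadricCosmology k q' := by
  ext1 p
  have hp : q p.1.rep p.1.rep = q' p.1.rep p.1.rep := by
    simp [h, p.2 _ p.rep_mem]
  simp only [quadricCosmology, hp]

end FlatModel

/-! ### Traces on the tractor space -/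

section TractorMetric

variable {E : Type*} [NormedAddCommGroup E] [NormedSpace ℝ E] [FiniteDimensional ℝ E]
  {b : E →L[ℝ] E →L[ℝ] ℝ}

omit [FiniteDimensional ℝ E] in
theorem tractorMetric_symm (hs : ∀ u v, b u v = b v u) (s t : Tractor E) :
    tractorMetric b s t = tractorMetric b t s := by
  rw [tractorMetric_apply, tractorMetric_apply, hs]
  ring

theorem tractorMetric_isInvertible (hb : b.IsInvertible) : (tractorMetric b).IsInvertible := by
  refine isInvertible_of_nondegenerate _ fun s hs ↦ ?_
  have h1 := hs (1, 0, 0)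
  have h2 := hs (0, 0, 1)
  have h3 : s.2.1 = 0 := by
    apply hb.injective
    ext v
    simpa [tractorMetric_apply] using hs (0, v, 0)
  simp [tractorMetric_apply] at h1 h2
  ext <;> simp [h1, h2, h3]

/-- Duality with respect to `k` interchanges `X` and `Y`, so the values on `(X, X)` and `(Y, Y)` do
not enter the trace. -/
theorem metricTrace_tractorMetric (hb : b.IsInvertible) (hs : ∀ u v, b u v = b v u)
    (B : Tractor E →L[ℝ] Tractor E →L[ℝ] ℝ) :
    metricTrace (tractorMetric b) (fun s t ↦ B s t) =
      B (1, 0, 0) (0, 0, 1) +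
        (metricTrace b (fun u v ↦ B (0, u, 0) (0, v, 0)) + B (0, 0, 1) (1, 0, 0)) := by
  rw [metricTrace_eq_sum (tractorMetric_isInvertible hb) (tractorMetric_symm hs) B
    ((Module.Basis.singleton Unit ℝ).prod
      ((Module.finBasis ℝ E).prod (Module.Basis.singleton Unit ℝ)))
    (Sum.elim (fun _ ↦ (0, 0, 1))
      (Sum.elim (fun i ↦ (0, b.inverse (coordForm E i), 0)) fun _ ↦ (1, 0, 0)))]
  · simp [metricTrace]
    rfl
  · rintro (_ | i | _) v
    · simp [tractorMetric_apply]
    · simp [tractorMetric_apply, apply_inverse_coordForm hb, coordForm_apply]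
    · simp [tractorMetric_apply]

end TractorMetric

/-! ### Existence and uniqueness of the osculating quadric -/

section Main

variable {E : Type*} [NormedAddCommGroup E] [NormedSpace ℝ E] [FiniteDimensional ℝ E]

/-- The second tractor `D`-derivative of the squared scale of a metric is trace free. -/
theorem IsLocalMetric.metricTrace_densityD2 {g : E → E →L[ℝ] E →L[ℝ] ℝ} {U : Set E} {y : E}
    (hg : IsLocalMetric g U) (hy : y ∈ U) (hn : 2 < Module.finrank ℝ E) :
    metricTrace (tractorMetric (g y)) (fun s t ↦ densityD2 g 2 (scaleSq g) y s t) = 0 := by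
  obtain ⟨c, hc⟩ := hg.exists_densityD2_apply hy hn
  have h1 : ∑ i, g y (Module.finBasis ℝ E i) ((g y).inverse (coordForm E i)) =
      Module.finrank ℝ E := metricTrace_self (hg.isInvertible y hy) (hg.symm y hy)
  have h2 : ∑ i, schouten g y (Module.finBasis ℝ E i) ((g y).inverse (coordForm E i)) =
      schoutenTrace g y := rfl
  rw [metricTrace_tractorMetric (hg.isInvertible y hy) (hg.symm y hy)]
  simp only [hc, metricTrace]
  -- The two `X`–`Y` entries contribute `-4nJ`, the block on the tangent space `n(2(n+2)J - 2nJ) =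
  -- 4nJ`.
  simp only [mul_zero, mul_one, add_zero, zero_add, sub_zero, map_zero,
    zero_sub, ← Finset.mul_sum, Finset.sum_sub_distrib, h1, h2]
  ring

variable {M : Type*} [TopologicalSpace M] [ChartedSpace E M] [IsManifold 𝓘(ℝ, E) ∞ M]

/-- Only the germ at `x` matters. Nondegeneracy at `x` itself spreads to a neighbourhood because
invertible maps form an open set, so invertibility of the chart differential elsewhere is never
needed. -/
theorem SpaceTimeMetric.exists_isLocalMetric (g : SpaceTimeMetric E M) (x : M) :
    ∃ U, extChartAt 𝓘(ℝ, E) x x ∈ U ∧ IsLocalMetric (g.inChart x) U := by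
  refine ⟨(extChartAt 𝓘(ℝ, E) x).target ∩ g.inChart x ⁻¹'
    Set.range ((↑) : (E ≃L[ℝ] (E →L[ℝ] ℝ)) → E →L[ℝ] E →L[ℝ] ℝ),
    ⟨mem_extChartAt_target x, ?_⟩, ?_, ?_, ?_, ?_⟩
  · rw [Set.mem_preimage, g.inChart_self]
    exact isInvertible_of_nondegenerate (E := E) (g.val x) (g.nondegenerate x)
  · exact (g.contDiffOn_inChart x).continuousOn.isOpen_inter_preimage
      (isOpen_extChartAt_target x) ContinuousLinearEquiv.isOpen
  · exact (g.contDiffOn_inChart x).mono Set.inter_subset_left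
  · intro y _ u v
    rw [SpaceTimeMetric.inChart_apply, SpaceTimeMetric.inChart_apply]
    exact g.symm _ _ _
  · exact fun y hy ↦ hy.2

end Main

theorem mainTheorem1 {E : Type*} [NormedAddCommGroup E] [NormedSpace ℝ E] [FiniteDimensional ℝ E]
    (hn : 2 < Module.finrank ℝ E)
    {M : Type*} [TopologicalSpace M] [ChartedSpace E M] [IsManifold 𝓘(ℝ, E) ∞ M]
    (g : SpaceTimeMetric E M) (x : M) :
    ∃! G : PartialMetric (g.tractorForm x), g.IsOsculatingQuadricCosmology x G := by
  obtain ⟨U, hy, hg⟩ := g.exists_isLocalMetric x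
  set y := extChartAt 𝓘(ℝ, E) x x with hydef
  set γ := g.inChart x with hγ
  have hk : g.tractorForm x = tractorMetric (γ y) := by
    rw [hγ, hydef, g.inChart_self]
    rfl
  have hdim : (Module.finrank ℝ (Tractor E) : ℝ) = (Module.finrank ℝ E : ℝ) + 2 := by
    simp only [Tractor, Module.finrank_prod, Module.finrank_self]
    push_cast
    ring
  have hn' : (2 : ℝ) < Module.finrank ℝ E := by exact_mod_cast hn
  set n : ℝ := (Module.finrank ℝ E : ℝ) with hndef
  have hn0 : n ≠ 0 := by linarith
  have hn2 : n + 2 ≠ 0 := by linarith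
  obtain ⟨c, hc⟩ := hg.exists_densityD2_apply hy hn
  rw [← hndef] at hc
  have htr := hg.metricTrace_densityD2 hy hn
  set S := densityD2 γ 2 (scaleSq γ) y with hS
  -- The factor inverts the one by which the model's `D²` multiplies a trace-free form.
  set q : Tractor E →L[ℝ] Tractor E →L[ℝ] ℝ := (2 * n * (n + 2))⁻¹ • S with hq
  have hSsymm : ∀ s t, S s t = S t s := by
    intro s t
    rw [hc, hc, hg.schouten_symm hy s.2.1, hg.symm y hy s.2.1]
    ring
  have hqsymm : ∀ s t, q s t = q t s := fun s t ↦ by simp [hq, hSsymm s t]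
  have hqtr : metricTrace (g.tractorForm x) (fun s t ↦ q s t) = 0 := by
    rw [hk]
    unfold metricTrace at htr ⊢
    simp only [hq, smul_apply, smul_eq_mul, ← Finset.mul_sum, htr, mul_zero]
  have hqX : q (Tractor.X E) (Tractor.X E) = 1 := by
    simp only [hq, smul_apply, hc, Tractor.X, smul_eq_mul]
    simp
    field_simp
  refine ⟨quadricCosmology (g.tractorForm x) q, ⟨q, hqsymm, ?_, rfl, ?_, ?_, ?_⟩, ?_⟩
  -- Evaluating on `(X, X)`, where `k = 0` and `q = 1`, and then on `(X, Y)`, where `k = 1`, kills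
  -- both coefficients.
  · rw [LinearIndependent.pair_iff]
    intro a d had
    have h1 := congrArg (fun L : Tractor E →L[ℝ] Tractor E →L[ℝ] ℝ ↦
      L (Tractor.X E) (Tractor.X E)) had
    have hX : g.tractorForm x (Tractor.X E) (Tractor.X E) = 0 := by
      simp [hk, tractorMetric_apply, Tractor.X]
    have hd : d = 0 := by simpa [hqX, hX] using h1
    have h2 := congrArg (fun L : Tractor E →L[ℝ] Tractor E →L[ℝ] ℝ ↦
      L (Tractor.X E) (0, 0, 1)) had
    exact ⟨by simpa [hd, hk, tractorMetric_apply, Tractor.X] using h2, hd⟩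
  · exact hqX.symm
  -- With `tr q = 0` the model derivative at `X` is `2(n+2) q(X, ·) = S(X, ·) / n`, which is the
  -- derivative of the scale.
  · rw [modelD_quadricScaleSq _ hqsymm, hqtr, hdim]
    refine ContinuousLinearMap.ext fun t ↦ ?_
    rw [densityD_scaleSq_apply]
    simp only [hq, smul_apply, hc, Tractor.X, smul_eq_mul, mul_zero, zero_smul,
      zero_mul, map_zero, zero_apply, one_mul, sub_zero, add_zero]
    field_simp
    simp [hγ, hydef, hndef]
    ring
  · rw [modelD2_quadricScaleSq _ hqsymm, hqtr, hdim, hq, mul_zero, zero_smul, sub_zero, smul_smul,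
      smul_smul]
    have h1 : (n + 2 - 2) * (2 * (n + 2)) * (2 * n * (n + 2))⁻¹ = 1 := by
      field_simp
      ring
    rw [h1, one_smul]
  -- Only the second derivatives are used: they make `q` the trace-free part of `q'`, so that `q' =
  -- q + (tr q' / (n+2)) k`.
  · rintro G ⟨q', hq', -, rfl, -, -, hD⟩
    rw [modelD2_quadricScaleSq _ hq', hdim] at hD
    change S = _ at hD
    refine quadricCosmology_congr
      (c := (metricTrace (g.tractorForm x) fun s t ↦ q' s t) / (n + 2)) ?_
    refine ContinuousLinearMap.ext fun s ↦ ContinuousLinearMap.ext fun t ↦ ?_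
    simp only [hq, hD, add_apply, smul_apply, sub_apply, smul_eq_mul]
    field_simp
    ring
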